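/- Let $p\in[1,\infty)$ and let $q_1,q_2\in L_p(0,1)$ be real-valued. Put $$B=\begin{pmatrix}0&1\\-1&0\end{pmatrix},\qquad Q(x)=\begin{pmatrix}q_1(x)&q_2(x)\\q_2(x)&-q_1(x)\end{pmatrix},\qquad \ell_Q\mathbf u=B\mathbf u'+Q\mathbf u .$$ For $j=1,2$ let $A_j$ be the operator in the complex Hilbert space $\mathbf H=L_2(0,1)\times L_2(0,1)$ acting by $A_j\mathbf u=\ell_Q\mathbf u$ on the domain of all $\mathbf u=(u_1,u_2)^{\mathrm t}$ such that $u_1,u_2$ are absolutely continuous on $[0,1]$, $\ell_Q\mathbf u\in\mathbf H$ and $u_2(0)=u_j(1)=0$. Then the eigenvalues of $A_1$ and of $A_2$, counted with multiplicity, can be enumerated as real sequences $(\lambda_n)_{n\in\mathbb Z}$ and $(\mu_n)_{n\in\mathbb Z}$, respectively, in such a way that $$\lambda_{n-1}<\mu_n<\lambda_n\qquad\text{for all } n\in\mathbb Z,$$ and at the same time, for some $g_1,g_2\in L_p(0,1)$ (possibly complex-valued), $$\lambda_n=\pi\bigl(n+\tfrac12\bigr)+e_n(g_1),\qquad \mu_n=\pi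 n+e_n(g_2)\qquad\text{for all } n\in\mathbb Z,$$ where $e_n(g)=\int_0^1 e^{-2\pi i n x}g(x)\,dx$ is the $n$-th Fourier coefficient of $g$. In particular, all these eigenvalues are real and simple. -/

import Mathlib

open MeasureTheory Set

noncomputable section

namespace Dirac

/-- Lebesgue measure on the interval `(0,1)`. -/
abbrev mu01 : Measure ℝ := volume.restrict (Ioo 0 1)

/-- The Hilbert space `L₂(0,1) × L₂(0,1)` of (classes of) complex vector functions. -/
abbrev H : Type := PiLp 2 (fun _ : Fin 2 => Lp ℂ 2 mu01)

/-- The constant matrix `B`. -/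
def B : Matrix (Fin 2) (Fin 2) ℂ := !![0, 1; -1, 0]

/-- The potential `Q(x)`, a real symmetric trace-free matrix built from `q₁` and `q₂`. -/
def Q (q₁ q₂ : ℝ → ℝ) (x : ℝ) : Matrix (Fin 2) (Fin 2) ℂ :=
  !![(q₁ x : ℂ), (q₂ x : ℂ); (q₂ x : ℂ), -(q₁ x : ℂ)]

/-- The differential expression `ℓ_Q v = B v' + Q v`, evaluated at the point `x`. -/
def ell (q₁ q₂ : ℝ → ℝ) (v : Fin 2 → ℝ → ℂ) (x : ℝ) : Fin 2 → ℂ :=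
  B.mulVec (fun k => deriv (v k) x) + (Q q₁ q₂ x).mulVec (fun k => v k x)

/-- `v = (v₁, v₂)` has absolutely continuous components on `[0,1]` and satisfies the boundary
conditions `v₂(0) = 0` and `v_j(1) = 0`. The index `0 : Fin 2` stands for the first component and
`1 : Fin 2` for the second one. -/
structure Admissible (j : Fin 2) (v : Fin 2 → ℝ → ℂ) : Prop where
  ac : ∀ k, AbsolutelyContinuousOnInterval (v k) 0 1
  left : v 1 0 = 0
  right : v j 1 = 0

/-- `(u, w) ∈ H × H` belongs to the graph of the Dirac operator if `u` has a representative `v`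
in the domain and `w` is the class of `ℓ_Q v` (in particular, `ℓ_Q v` is square integrable). -/
def InGraph (q₁ q₂ : ℝ → ℝ) (j : Fin 2) (u w : H) : Prop :=
  ∃ v : Fin 2 → ℝ → ℂ, Admissible j v ∧ (∀ k, u k =ᵐ[mu01] v k) ∧
    ∀ k, w k =ᵐ[mu01] fun x => ell q₁ q₂ v x k

theorem ac_ae_differentiableAt {f : ℝ → ℂ} (hf : AbsolutelyContinuousOnInterval f 0 1) :
    ∀ᵐ x ∂mu01, DifferentiableAt ℝ f x := by
  have h := hf.boundedVariationOn.ae_differentiableAt_of_mem_uIcc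
  rw [ae_restrict_iff' measurableSet_Ioo]
  filter_upwards [h] with x hx hx'
  exact hx (by rw [uIcc_of_le zero_le_one]; exact Ioo_subset_Icc_self hx')

/-- The graph of the Dirac operator, as a linear subspace of `H × H`. -/
def graph (q₁ q₂ : ℝ → ℝ) (j : Fin 2) : Submodule ℂ (H × H) where
  carrier := {z | InGraph q₁ q₂ j z.1 z.2}
  zero_mem' := by
    refine ⟨fun _ _ => 0, ⟨fun k => ?_, rfl, rfl⟩, fun k => ?_, fun k => ?_⟩
    · exact (LipschitzOnWith.of_dist_le_mul (K := 0) (by simp)).absolutelyContinuousOnInterval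
    · exact Lp.coeFn_zero ℂ 2 mu01
    · filter_upwards [Lp.coeFn_zero ℂ 2 mu01] with x hx
      have : ell q₁ q₂ (fun _ _ => 0) x = 0 := by
        ext i; fin_cases i <;> simp [ell, B, Q, dotProduct]
      rw [this]; exact hx
  add_mem' := by
    rintro ⟨u, w⟩ ⟨u', w'⟩ ⟨v, hv, hu, hw⟩ ⟨v', hv', hu', hw'⟩
    refine ⟨fun k x => v k x + v' k x, ⟨fun k => (hv.ac k).add (hv'.ac k), ?_, ?_⟩,
      fun k => ?_, fun k => ?_⟩
    · simp [hv.left, hv'.left]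
    · simp [hv.right, hv'.right]
    · filter_upwards [Lp.coeFn_add (u k) (u' k), hu k, hu' k] with x h1 h2 h3
      simpa [h2, h3] using h1
    · filter_upwards [Lp.coeFn_add (w k) (w' k), hw k, hw' k,
        ac_ae_differentiableAt (hv.ac 0), ac_ae_differentiableAt (hv.ac 1),
        ac_ae_differentiableAt (hv'.ac 0), ac_ae_differentiableAt (hv'.ac 1)]
        with x h1 h2 h3 d0 d1 d0' d1'
      have e : ell q₁ q₂ (fun k x => v k x + v' k x) x = ell q₁ q₂ v x + ell q₁ q₂ v' x := by
        ext i; fin_cases i <;>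
          simp [ell, B, Q, dotProduct, deriv_fun_add d0 d0', deriv_fun_add d1 d1'] <;>
          ring
      rw [e, Pi.add_apply, ← h2, ← h3]
      exact h1
  smul_mem' := by
    rintro c ⟨u, w⟩ ⟨v, hv, hu, hw⟩
    refine ⟨fun k x => c • v k x, ⟨fun k => (hv.ac k).const_smul c, ?_, ?_⟩,
      fun k => ?_, fun k => ?_⟩
    · simp [hv.left]
    · simp [hv.right]
    · filter_upwards [Lp.coeFn_smul c (u k), hu k] with x h1 h2
      simpa [h2] using h1
    · filter_upwards [Lp.coeFn_smul c (w k), hw k,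
        ac_ae_differentiableAt (hv.ac 0), ac_ae_differentiableAt (hv.ac 1)] with x h1 h2 d0 d1
      have e : ell q₁ q₂ (fun k x => c • v k x) x = c • ell q₁ q₂ v x := by
        ext i; fin_cases i <;>
          simp [ell, B, Q, dotProduct] <;> ring
      rw [e, Pi.smul_apply, ← h2]
      exact h1

/-- The graph is the graph of a function. -/
theorem graph_single_valued (q₁ q₂ : ℝ → ℝ) (j : Fin 2) (z : H × H) (hz : z ∈ graph q₁ q₂ j)
    (h0 : z.1 = 0) : z.2 = 0 := by
  obtain ⟨v, hv, hu, hw⟩ := hz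
  have hv0 : ∀ k, ∀ x ∈ Ioo (0 : ℝ) 1, v k x = 0 := by
    intro k
    have hae : v k =ᵐ[mu01] fun _ => 0 := by
      have h1 := hu k
      rw [h0] at h1
      exact h1.symm.trans (Lp.coeFn_zero ℂ 2 mu01)
    have hc : ContinuousOn (v k) (Ioo 0 1) := (hv.ac k).continuousOn.mono (by
      rw [uIcc_of_le zero_le_one]; exact Ioo_subset_Icc_self)
    exact Measure.eqOn_open_of_ae_eq hae isOpen_Ioo hc continuousOn_const
  have hd : ∀ k, ∀ x ∈ Ioo (0 : ℝ) 1, deriv (v k) x = 0 := by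
    intro k x hx
    have : v k =ᶠ[nhds x] fun _ => 0 := by
      filter_upwards [isOpen_Ioo.mem_nhds hx] with y hy using hv0 k y hy
    rw [this.deriv_eq]; simp
  ext k : 1
  apply Lp.ext
  refine (hw k).trans (Filter.EventuallyEq.trans ?_ (Lp.coeFn_zero ℂ 2 mu01).symm)
  filter_upwards [ae_restrict_mem measurableSet_Ioo] with x hx
  have e : ell q₁ q₂ v x = 0 := by
    ext i; fin_cases i <;> simp [ell, B, Q, dotProduct, hv0 _ x hx, hd _ x hx]
  rw [e]; rfl

/-- The Dirac operator in `H`: `diracOp q₁ q₂ 0` acts by `ℓ_Q` with boundary conditions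
`u₂(0) = u₁(1) = 0`, and `diracOp q₁ q₂ 1` acts by `ℓ_Q` with boundary conditions
`u₂(0) = u₂(1) = 0`. -/
def diracOp (q₁ q₂ : ℝ → ℝ) (j : Fin 2) : H →ₗ.[ℂ] H := (graph q₁ q₂ j).toLinearPMap

theorem graph_diracOp (q₁ q₂ : ℝ → ℝ) (j : Fin 2) :
    (diracOp q₁ q₂ j).graph = graph q₁ q₂ j :=
  Submodule.toLinearPMap_graph_eq _ (graph_single_valued q₁ q₂ j)

/-- The eigenspace `{u ∈ dom A | A u = z u}` of a partially defined linear operator. -/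
def eigenspace (A : H →ₗ.[ℂ] H) (z : ℂ) : Submodule ℂ A.domain :=
  LinearMap.ker (A.toFun - z • A.domain.subtype)

/-- `z` is an eigenvalue of `A`: `A u = z u` for some non-zero `u` in the domain of `A`. -/
def IsEigenvalue (A : H →ₗ.[ℂ] H) (z : ℂ) : Prop :=
  ∃ u : A.domain, (u : H) ≠ 0 ∧ A u = z • (u : H)

/-- The real sequence `ν`, indexed by `ℤ`, enumerates the eigenvalues of `A`, each of them being
repeated according to its multiplicity (all eigenvalues of `A` are then real). -/
def EnumeratesEigenvalues (A : H →ₗ.[ℂ] H) (ν : ℤ → ℝ) : Prop :=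
  (∀ z : ℂ, IsEigenvalue A z ↔ ∃ n, (ν n : ℂ) = z) ∧
    ∀ n, Module.rank ℂ (eigenspace A (ν n)) = Cardinal.mk {m : ℤ // ν m = ν n}

/-- The Fourier coefficient `e_n(g) = ∫₀¹ exp(-2πinx) g(x) dx`. -/
def fourierCoef (g : ℝ → ℂ) (n : ℤ) : ℂ :=
  ∫ x in Ioo (0 : ℝ) 1, Complex.exp (-(2 * Real.pi * n * x) * Complex.I) * g x

end Dirac

end

noncomputable section

namespace Dirac

/-! ### Absolutely continuous functions and their primitives -/

section

/-! For real `l` the solution with `v₂(0) = 0` is `exp(R) (cos θ, sin θ)`, where `θ(0) = 0` and `θ'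
= l - q₁ cos 2θ - q₂ sin 2θ`. The boundary condition at `1` then reads `cos θ(l,1) = 0` or `sin
θ(l,1) = 0`; non-real eigenvalues are excluded by the Lagrange identity. Since `l ↦ θ(l,1)` is a
strictly increasing bijection of the line (`exists_pruferAngle_family`), the eigenvalues are the
preimages of `π(n + 1/2)` and `πn`. Simplicity and interlacing are immediate.

For the asymptotics, the amplitude `a(t) = exp(R + i(θ - lt))` solves `a' = -iq exp(-2ilt) conj a`
with `q = q₁ + i q₂`. One Volterra equation in `L_p`, not involving `l`, produces kernels `k_t` with
`a(t) = 1 + ∫ exp(-2ilx) k_t(x) dx` for every `l` (`exists_transformation_kernel`).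
Riemann–Lebesgue, uniform in `t`, gives `θ(l,1) - l → 0`, so the remainders `ρ_n` of the eigenvalues
tend to `0`. Because `exp(iρ_n) a(1)` is real, they satisfy `sin ρ_n + e_n(exp(iρ_n(1 - 2x)) f) = 0`
with a fixed `f` in `L_p`.

Expanding in powers of `ρ_n` turns this into `sin ρ_n + ∑ ρ_n^k e_n(a_k) = 0`. On the circle `L_p`
is a convolution algebra and each `e_n` is multiplicative, so it suffices to solve `sin y + ∑ y^k
b_k = 0` in `L_p`. A contraction does this once the `b_k` are small, which is achieved by changing
the `a_k` by trigonometric polynomials, hence at finitely many frequencies. Uniqueness of small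
scalar solutions gives `e_n(y) = ρ_n` for all but finitely many `n`, and the others are corrected by
hand (`exists_fourierCoef_eq_of_sin_add_eq_zero`). -/

theorem _root_.AbsolutelyContinuousOnInterval.comp_lipschitzOnWith {X Y : Type*}
    [PseudoMetricSpace X] [PseudoMetricSpace Y] {f : ℝ → X} {φ : X → Y} {K : NNReal} {s : Set X}
    {a b : ℝ} (hf : AbsolutelyContinuousOnInterval f a b) (hφ : LipschitzOnWith K φ s)
    (hs : ∀ x ∈ uIcc a b, f x ∈ s) : AbsolutelyContinuousOnInterval (fun x => φ (f x)) a b := by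
  rw [absolutelyContinuousOnInterval_iff] at hf ⊢
  intro ε hε
  obtain ⟨δ, hδ, h⟩ := hf (ε / (K + 1)) (by positivity)
  refine ⟨δ, hδ, fun E hE hE' => ?_⟩
  calc _ ≤ ∑ i ∈ Finset.range E.1, (K : ℝ) * dist (f (E.2 i).1) (f (E.2 i).2) := by
        refine Finset.sum_le_sum fun i hi => ?_
        exact hφ.dist_le_mul _ (hs _ (hE.1 i hi).1) _ (hs _ (hE.1 i hi).2)
    _ = K * ∑ i ∈ Finset.range E.1, dist (f (E.2 i).1) (f (E.2 i).2) := by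
        rw [Finset.mul_sum]
    _ ≤ K * (ε / (K + 1)) := by
        have := (h E hE hE').le
        gcongr
    _ < (K + 1) * (ε / (K + 1)) := by gcongr; linarith
    _ = ε := by field

/-- The range of `f` lies in a closed ball, which is compact and convex in finite dimension, so a
`C¹` map is Lipschitz there. -/
theorem _root_.AbsolutelyContinuousOnInterval.comp_contDiff {E F : Type*}
    [NormedAddCommGroup E] [NormedSpace ℝ E] [FiniteDimensional ℝ E]
    [NormedAddCommGroup F] [NormedSpace ℝ F] {f : ℝ → E} {φ : E → F}
    {a b : ℝ} (hf : AbsolutelyContinuousOnInterval f a b) (hφ : ContDiff ℝ 1 φ) :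
    AbsolutelyContinuousOnInterval (fun x => φ (f x)) a b := by
  obtain ⟨C, hC⟩ := hf.exists_bound
  obtain ⟨K, hK⟩ := (hφ.contDiffOn (s := Metric.closedBall 0 C)).exists_lipschitzOnWith
    (by decide) (convex_closedBall _ _) (isCompact_closedBall _ _)
  exact hf.comp_lipschitzOnWith hK fun x hx => by simpa using hC x hx

theorem _root_.IntervalIntegrable.complex_ofReal {g : ℝ → ℝ} {a b : ℝ}
    (h : IntervalIntegrable g volume a b) :
    IntervalIntegrable (fun x => (g x : ℂ)) volume a b := ⟨h.1.ofReal, h.2.ofReal⟩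

theorem _root_.IntervalIntegrable.absolutelyContinuousOnInterval_integral_complex {g : ℝ → ℂ}
    {a b : ℝ} (h : IntervalIntegrable g volume a b) :
    AbsolutelyContinuousOnInterval (fun x => ∫ t in a..x, g t) a b := by
  have hre : IntervalIntegrable (fun t => (g t).re) volume a b :=
    ⟨h.1.re, h.2.re⟩
  have him : IntervalIntegrable (fun t => (g t).im) volume a b :=
    ⟨h.1.im, h.2.im⟩
  have h1 := (hre.absolutelyContinuousOnInterval_intervalIntegral
    (left_mem_uIcc)).comp_contDiff (φ := fun x : ℝ => (x : ℂ)) Complex.ofRealCLM.contDiff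
  have h2 := (him.absolutelyContinuousOnInterval_intervalIntegral
    (left_mem_uIcc)).comp_contDiff (φ := fun x : ℝ => (x : ℂ) * Complex.I)
      (Complex.ofRealCLM.contDiff.mul contDiff_const)
  have h3 := h1.add h2
  refine (absolutelyContinuousOnInterval_iff _ _ _).2 fun ε hε => ?_
  obtain ⟨δ, hδ, H⟩ := (absolutelyContinuousOnInterval_iff _ _ _).1 h3 ε hε
  refine ⟨δ, hδ, fun E hE hE' => ?_⟩
  refine lt_of_eq_of_lt (Finset.sum_congr rfl fun i hi => ?_) (H E hE hE')
  have key : ∀ x ∈ uIcc a b, ∫ t in a..x, g t =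
      ((∫ t in a..x, (g t).re : ℝ) : ℂ) + ((∫ t in a..x, (g t).im : ℝ) : ℂ) * Complex.I := by
    intro x hx
    have hs : uIcc a x ⊆ uIcc a b := uIcc_subset_uIcc left_mem_uIcc hx
    rw [← intervalIntegral.integral_ofReal, ← intervalIntegral.integral_ofReal,
      ← intervalIntegral.integral_mul_const, ← intervalIntegral.integral_add]
    · simp only [Complex.re_add_im]
    · exact ((hre.mono_set hs).complex_ofReal)
    · exact ((him.mono_set hs).complex_ofReal.mul_const _)
  rw [key _ (hE.1 i hi).1, key _ (hE.1 i hi).2]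
  rfl

/-- An absolutely continuous complex function is recovered from its a.e. derivative. -/
theorem _root_.AbsolutelyContinuousOnInterval.ftc_complex {f g : ℝ → ℂ} {a b : ℝ} (hab : a ≤ b)
    (hf : AbsolutelyContinuousOnInterval f a b)
    (hg : ∀ᵐ x ∂(volume.restrict (Ioo a b)), HasDerivAt f (g x) x) :
    IntervalIntegrable g volume a b ∧ ∀ x ∈ Icc a b, f x = f a + ∫ t in a..x, g t := by
  have hg' : ∀ᵐ x, x ∈ uIcc a b → HasDerivAt f (g x) x := by
    have h₁ : ∀ᵐ x : ℝ, x ≠ a := by simp [ae_iff, measure_singleton]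
    have h₂ : ∀ᵐ x : ℝ, x ≠ b := by simp [ae_iff, measure_singleton]
    rw [ae_restrict_iff' measurableSet_Ioo] at hg
    filter_upwards [hg, h₁, h₂] with x hx ha hb hx'
    rw [uIcc_of_le hab] at hx'
    exact hx ⟨lt_of_le_of_ne hx'.1 ha.symm, lt_of_le_of_ne hx'.2 hb⟩
  have hre := hf.comp_contDiff (φ := Complex.re) Complex.reCLM.contDiff
  have him := hf.comp_contDiff (φ := Complex.im) Complex.imCLM.contDiff
  have i1 := hre.intervalIntegrable_deriv
  have i2 := him.intervalIntegrable_deriv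
  have i3 : IntervalIntegrable g volume a b := by
    refine (i1.complex_ofReal.add (i2.complex_ofReal.mul_const Complex.I) : IntervalIntegrable (fun x =>
      ((deriv (fun x => (f x).re) x : ℝ) : ℂ) + ((deriv (fun x => (f x).im) x : ℝ) : ℂ)
        * Complex.I) volume a b).congr_ae ?_
    rw [Filter.EventuallyEq, ae_restrict_iff' measurableSet_uIoc]
    filter_upwards [hg'] with x hx hx'
    have hd := hx (uIoc_subset_uIcc hx')
    have d1 : HasDerivAt (fun x => (f x).re) (g x).re x :=
      (Complex.reCLM.hasFDerivAt (x := f x)).comp_hasDerivAt x hd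
    have d2 : HasDerivAt (fun x => (f x).im) (g x).im x :=
      (Complex.imCLM.hasFDerivAt (x := f x)).comp_hasDerivAt x hd
    rw [d1.deriv, d2.deriv, Complex.re_add_im]
  refine ⟨i3, ?_⟩
  -- The difference of `f` and the primitive of `g` is absolutely continuous with derivative zero
  -- almost everywhere, hence constant.
  have hac := hf.sub i3.absolutelyContinuousOnInterval_integral_complex
  obtain ⟨C, hC⟩ := hac.const_of_ae_hasDerivAt_zero (by
    filter_upwards [hg', i3.ae_hasDerivAt_integral] with x h1 h2 hx
    convert! (h1 hx).sub (h2 hx a left_mem_uIcc) using 1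
    simp)
  rw [uIcc_of_le hab] at hC
  intro x hx
  have h1 := hC x hx
  have h2 := hC a (left_mem_Icc.2 hab)
  simp only [Pi.sub_apply, intervalIntegral.integral_same, sub_zero] at h1 h2
  rw [h2, ← h1]; ring

/-- The integrand is the derivative of `exp(2 ∫ k) / 2`. The denominator `2` becomes the contraction
constant of the Volterra operators below. -/
theorem integral_mul_exp_two_mul_integral {k : ℝ → ℝ} (hk : IntervalIntegrable k volume 0 1)
    {t : ℝ} (ht : t ∈ Icc (0 : ℝ) 1) :
    ∫ s in (0 : ℝ)..t, k s * Real.exp (2 * ∫ r in (0 : ℝ)..s, k r) =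
      (Real.exp (2 * ∫ r in (0 : ℝ)..t, k r) - 1) / 2 := by
  have hk' : IntervalIntegrable k volume 0 t := hk.mono_set
    (uIcc_subset_uIcc left_mem_uIcc (by rwa [uIcc_of_le zero_le_one]))
  have hac := (hk'.absolutelyContinuousOnInterval_intervalIntegral left_mem_uIcc).comp_contDiff
    (φ := fun y : ℝ => Real.exp (2 * y) / 2) (by fun_prop)
  have h := hac.integral_deriv_eq_sub
  simp only [intervalIntegral.integral_same, mul_zero, Real.exp_zero] at h
  rw [sub_div, ← h]
  refine intervalIntegral.integral_congr_ae ?_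
  filter_upwards [hk'.ae_hasDerivAt_integral] with s hs hs'
  have hd := (((hs (uIoc_subset_uIcc hs') 0 left_mem_uIcc).const_mul 2).exp).div_const 2
  rw [hd.deriv]; ring

end

/-! ### Nonlinear Volterra equations with an integrable Lipschitz constant -/

section

section Volterra

variable {E : Type*} [NormedAddCommGroup E] [NormedSpace ℝ E]

/-- In the sup norm weighted by `exp(-2 ∫ k)` the Volterra operator halves distances on the whole
interval, however large `∫ k` is. -/
theorem volterra_dist_le {F : ℝ → E → E} {k : ℝ → ℝ}
    (hk : IntervalIntegrable k volume 0 1)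
    (hF : ∀ t ∈ Icc (0 : ℝ) 1, ∀ x y, ‖F t x - F t y‖ ≤ k t * ‖x - y‖) {u v : ℝ → E}
    (hu : IntervalIntegrable (fun s => F s (u s)) volume 0 1)
    (hv : IntervalIntegrable (fun s => F s (v s)) volume 0 1) {M : ℝ}
    (hM : ∀ s ∈ Icc (0 : ℝ) 1, ‖u s - v s‖ ≤ Real.exp (2 * ∫ r in (0 : ℝ)..s, k r) * M)
    (hk0 : ∀ t ∈ Icc (0 : ℝ) 1, 0 ≤ k t) {t : ℝ} (ht : t ∈ Icc (0 : ℝ) 1) :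
    ‖(∫ s in (0 : ℝ)..t, F s (u s)) - ∫ s in (0 : ℝ)..t, F s (v s)‖ ≤
      Real.exp (2 * ∫ r in (0 : ℝ)..t, k r) * (M / 2) := by
  have hsub : uIcc 0 t ⊆ uIcc (0 : ℝ) 1 :=
    uIcc_subset_uIcc left_mem_uIcc (by rwa [uIcc_of_le zero_le_one])
  have hk' := hk.mono_set hsub
  have hM0 : 0 ≤ M := by
    have := (norm_nonneg _).trans (hM 0 (left_mem_Icc.2 zero_le_one))
    simpa using this
  rw [← intervalIntegral.integral_sub (hu.mono_set hsub) (hv.mono_set hsub)]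
  calc _ ≤ ∫ s in (0 : ℝ)..t, k s * Real.exp (2 * ∫ r in (0 : ℝ)..s, k r) * M := by
        refine intervalIntegral.norm_integral_le_of_norm_le ht.1 ?_ ?_
        · refine Filter.Eventually.of_forall fun s hs => ?_
          have hs' : s ∈ Icc (0 : ℝ) 1 := ⟨hs.1.le, hs.2.trans ht.2⟩
          refine (hF s hs' _ _).trans ?_
          rw [mul_assoc]
          exact mul_le_mul_of_nonneg_left (hM s hs') (hk0 s hs')
        · refine (hk'.mul_continuousOn ?_).mul_const M
          exact Real.continuous_exp.comp_continuousOn (continuousOn_const.mul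
            (hk'.absolutelyContinuousOnInterval_intervalIntegral left_mem_uIcc).continuousOn)
    _ = (Real.exp (2 * ∫ r in (0 : ℝ)..t, k r) - 1) / 2 * M := by
        rw [intervalIntegral.integral_mul_const, integral_mul_exp_two_mul_integral hk ht]
    _ ≤ _ := by nlinarith

/-- Iterating the halving estimate bounds the distance of two solutions by a constant times `2⁻ⁿ`
for every `n`. -/
theorem volterra_unique {F : ℝ → E → E} {k : ℝ → ℝ}
    (hk : IntervalIntegrable k volume 0 1) (hk0 : ∀ t ∈ Icc (0 : ℝ) 1, 0 ≤ k t)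
    (hF : ∀ t ∈ Icc (0 : ℝ) 1, ∀ x y, ‖F t x - F t y‖ ≤ k t * ‖x - y‖) {x₀ u v : ℝ → E}
    (hu : IntervalIntegrable (fun s => F s (u s)) volume 0 1)
    (hv : IntervalIntegrable (fun s => F s (v s)) volume 0 1)
    (huc : ContinuousOn u (Icc 0 1)) (hvc : ContinuousOn v (Icc 0 1))
    (hu' : ∀ t ∈ Icc (0 : ℝ) 1, u t = x₀ t + ∫ s in (0 : ℝ)..t, F s (u s))
    (hv' : ∀ t ∈ Icc (0 : ℝ) 1, v t = x₀ t + ∫ s in (0 : ℝ)..t, F s (v s)) :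
    ∀ t ∈ Icc (0 : ℝ) 1, u t = v t := by
  obtain ⟨M, hM⟩ := isCompact_Icc.exists_bound_of_continuousOn (huc.sub hvc)
  have hG0 : ∀ s ∈ Icc (0 : ℝ) 1, 1 ≤ Real.exp (2 * ∫ r in (0 : ℝ)..s, k r) := by
    intro s hs
    refine Real.one_le_exp (mul_nonneg zero_le_two ?_)
    exact intervalIntegral.integral_nonneg hs.1 fun r hr => hk0 r ⟨hr.1, hr.2.trans hs.2⟩
  have hM0 : 0 ≤ M := (norm_nonneg _).trans (hM 0 (left_mem_Icc.2 zero_le_one))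
  have key : ∀ n : ℕ, ∀ s ∈ Icc (0 : ℝ) 1,
      ‖u s - v s‖ ≤ Real.exp (2 * ∫ r in (0 : ℝ)..s, k r) * (M * (1 / 2) ^ n) := by
    intro n
    induction n with
    | zero =>
      intro s hs
      refine (hM s hs).trans ?_
      rw [pow_zero, mul_one]
      exact le_mul_of_one_le_left hM0 (hG0 s hs)
    | succ n ih =>
      intro s hs
      rw [hu' s hs, hv' s hs, add_sub_add_left_eq_sub]
      refine (volterra_dist_le hk hF hu hv ih hk0 hs).trans (le_of_eq ?_)
      rw [pow_succ]; ring
  intro t ht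
  have hlim : Filter.Tendsto (fun n : ℕ => Real.exp (2 * ∫ r in (0 : ℝ)..t, k r) *
      (M * (1 / 2) ^ n)) Filter.atTop (nhds 0) := by
    have := (tendsto_pow_atTop_nhds_zero_of_lt_one (r := (1 / 2 : ℝ)) (by norm_num)
      (by norm_num)).const_mul M |>.const_mul (Real.exp (2 * ∫ r in (0 : ℝ)..t, k r))
    simpa using this
  have h0 : ‖u t - v t‖ ≤ 0 := ge_of_tendsto' hlim fun n => key n t ht
  exact sub_eq_zero.1 (norm_le_zero_iff.1 h0)

variable [CompleteSpace E]

/-- Banach's fixed point theorem in the weighted norm. The closed sets `C t` carry a property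
preserved by the iteration; they are everything for the Prüfer angle, and encode support in `[0,t]`
for the kernels. -/
theorem volterra_exists {F : ℝ → E → E} {k : ℝ → ℝ}
    (hk : IntervalIntegrable k volume 0 1) (hk0 : ∀ t ∈ Icc (0 : ℝ) 1, 0 ≤ k t)
    (hF : ∀ t ∈ Icc (0 : ℝ) 1, ∀ x y, ‖F t x - F t y‖ ≤ k t * ‖x - y‖)
    (hint : ∀ v : ℝ → E, Continuous v → IntervalIntegrable (fun s => F s (v s)) volume 0 1)
    {x₀ : ℝ → E} (hx₀ : ContinuousOn x₀ (Icc 0 1)) {C : ℝ → Set E} (hCc : ∀ t, IsClosed (C t))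
    (hC : ∀ v : ℝ → E, Continuous v → (∀ s ∈ Icc (0 : ℝ) 1, v s ∈ C s) →
      ∀ t ∈ Icc (0 : ℝ) 1, x₀ t + ∫ s in (0 : ℝ)..t, F s (v s) ∈ C t)
    {v₀ : ℝ → E} (hv₀ : Continuous v₀) (hv₀C : ∀ s ∈ Icc (0 : ℝ) 1, v₀ s ∈ C s) :
    ∃ u : ℝ → E, Continuous u ∧ (∀ t ∈ Icc (0 : ℝ) 1, u t ∈ C t) ∧
      ∀ t ∈ Icc (0 : ℝ) 1, u t = x₀ t + ∫ s in (0 : ℝ)..t, F s (u s) := by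
  set G : ℝ → ℝ := fun t => 2 * ∫ r in (0 : ℝ)..t, k r with hG
  have hGc : ContinuousOn G (Icc 0 1) := by
    have := (hk.absolutelyContinuousOnInterval_intervalIntegral left_mem_uIcc).continuousOn
    rw [uIcc_of_le zero_le_one] at this
    exact continuousOn_const.mul this
  let I := Icc (0 : ℝ) 1
  have hGI : Continuous fun t : I => G t := continuousOn_iff_continuous_domRestrict.1 hGc
  -- A point `u` of `C(I, E)` stands for the function `exp(G) u`, so the ordinary sup norm of `u` is
  -- the weighted norm of that function.
  let ext : C(I, E) → ℝ → E := fun u s =>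
    Real.exp (G (projIcc 0 1 zero_le_one s)) • u (projIcc 0 1 zero_le_one s)
  have hext : ∀ u, Continuous (ext u) := by
    intro u
    have h1 : Continuous fun s => G (projIcc (0 : ℝ) 1 zero_le_one s) :=
      hGI.comp continuous_projIcc
    exact (Real.continuous_exp.comp h1).smul (u.continuous.comp continuous_projIcc)
  have hext' : ∀ u : C(I, E), ∀ s : I, ext u s = Real.exp (G s) • u s := by
    intro u s
    simp only [ext, projIcc_val]
  have hΨc : ∀ u : C(I, E), Continuous fun t : I =>
      Real.exp (-G t) • (x₀ t + ∫ s in (0 : ℝ)..t, F s (ext u s)) := by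
    intro u
    have h1 : ContinuousOn (fun t => ∫ s in (0 : ℝ)..t, F s (ext u s)) (Icc 0 1) := by
      have := intervalIntegral.continuousOn_primitive_interval'
        (hint _ (hext u)) (left_mem_uIcc)
      rwa [uIcc_of_le zero_le_one] at this
    have h2 := continuousOn_iff_continuous_domRestrict.1 (hx₀.add h1)
    exact (Real.continuous_exp.comp hGI.neg).smul h2
  let Ψ : C(I, E) → C(I, E) := fun u => ⟨_, hΨc u⟩
  have hΨ : ∀ u (t : I), Ψ u t = Real.exp (-G t) • (x₀ t + ∫ s in (0 : ℝ)..t, F s (ext u s)) :=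
    fun _ _ => rfl
  have hlip : ContractingWith (1 / 2) Ψ := by
    refine ⟨by rw [← NNReal.coe_lt_coe]; norm_num, LipschitzWith.of_dist_le_mul fun u v => ?_⟩
    rw [ContinuousMap.dist_le (by positivity)]
    intro t
    rw [dist_eq_norm, hΨ, hΨ, ← smul_sub, add_sub_add_left_eq_sub, norm_smul, Real.norm_eq_abs,
      abs_of_pos (Real.exp_pos _)]
    have := volterra_dist_le hk hF (hint _ (hext u)) (hint _ (hext v)) (M := dist u v) (by
      intro s hs
      have h1 := hext' u ⟨s, hs⟩
      have h2 := hext' v ⟨s, hs⟩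
      simp only at h1 h2
      rw [h1, h2, ← smul_sub, norm_smul, Real.norm_eq_abs, abs_of_pos (Real.exp_pos _),
        ← dist_eq_norm]
      gcongr
      exact ContinuousMap.dist_apply_le_dist _) hk0 t.2
    calc _ ≤ Real.exp (-G t) * (Real.exp (G t) * (dist u v / 2)) := by gcongr
      _ = Real.exp (-G t) * Real.exp (G t) * (dist u v / 2) := by ring
      _ = _ := by rw [← Real.exp_add, neg_add_cancel, Real.exp_zero]; push_cast; ring
  let S : Set C(I, E) := {u | ∀ t : I, Real.exp (G t) • u t ∈ C t}
  have hS : IsClosed S := by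
    have : S = ⋂ t : I, (fun u : C(I, E) => Real.exp (G t) • u t) ⁻¹' C t := by
      ext u; simp [S]
    rw [this]
    refine isClosed_iInter fun t => (hCc t).preimage ?_
    exact (continuous_eval_const t).const_smul _
  have hmaps : MapsTo Ψ S S := by
    intro u hu t
    rw [hΨ, smul_smul, ← Real.exp_add, add_neg_cancel, Real.exp_zero, one_smul]
    refine hC _ (hext u) (fun s hs => ?_) t t.2
    have h1 := hext' u ⟨s, hs⟩
    simp only at h1
    rw [h1]
    exact hu ⟨s, hs⟩
  let w : C(I, E) := ⟨fun t => Real.exp (-G t) • v₀ t,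
    (Real.continuous_exp.comp hGI.neg).smul (hv₀.comp continuous_subtype_val)⟩
  have hw : w ∈ S := by
    intro t
    change Real.exp (G t) • Real.exp (-G t) • v₀ t ∈ C t
    rw [smul_smul, ← Real.exp_add, add_neg_cancel, Real.exp_zero, one_smul]
    exact hv₀C t t.2
  obtain ⟨u, huS, hu, -⟩ := ContractingWith.exists_fixedPoint' hS.isComplete hmaps
    (hlip.restrict hmaps) hw (edist_ne_top _ _)
  refine ⟨ext u, hext u, fun t ht => ?_, fun t ht => ?_⟩
  · have h1 := hext' u ⟨t, ht⟩
    simp only at h1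
    rw [h1]; exact huS ⟨t, ht⟩
  · have h1 := hext' u ⟨t, ht⟩
    simp only at h1
    rw [h1, ← congrArg (fun v : C(I, E) => v ⟨t, ht⟩) hu, hΨ, smul_smul, ← Real.exp_add,
      add_neg_cancel, Real.exp_zero, one_smul]

end Volterra

end

/-! ### The Prüfer angle and its dependence on the spectral parameter -/

section

/-- Solve `d' = c + K d` with the integrating factor: `d(1) = exp(κ(1)) ∫ c exp(-κ)`, where `κ` is
the primitive of `K` and `|κ| ≤ M`. -/
theorem volterra_linear_bounds {d K : ℝ → ℝ} {c M : ℝ} (hc : 0 ≤ c) (hd : Continuous d)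
    (hK : IntervalIntegrable K volume 0 1)
    (hM : ∀ t ∈ Icc (0 : ℝ) 1, |∫ s in (0 : ℝ)..t, K s| ≤ M)
    (h : ∀ t ∈ Icc (0 : ℝ) 1, d t = ∫ s in (0 : ℝ)..t, (c + K s * d s)) :
    c * Real.exp (-(2 * M)) ≤ d 1 ∧ d 1 ≤ c * Real.exp (2 * M) := by
  set κ : ℝ → ℝ := fun t => ∫ s in (0 : ℝ)..t, K s with hκ
  have hKd : IntervalIntegrable (fun s => c + K s * d s) volume 0 1 :=
    intervalIntegrable_const.add (hK.mul_continuousOn hd.continuousOn)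
  have a1 := hKd.absolutelyContinuousOnInterval_intervalIntegral left_mem_uIcc
  have a2 := hK.absolutelyContinuousOnInterval_intervalIntegral left_mem_uIcc
  have a3 := a1.mul (a2.comp_contDiff (φ := fun y : ℝ => Real.exp (-y)) (by fun_prop))
  have hft := a3.integral_deriv_eq_sub
  have hκc : ContinuousOn κ (Icc 0 1) := by
    have := a2.continuousOn
    rwa [uIcc_of_le zero_le_one] at this
  have hw : ∫ s in (0 : ℝ)..1, c * Real.exp (-κ s) = d 1 * Real.exp (-κ 1) := by
    simp only [Pi.mul_apply, intervalIntegral.integral_same, zero_mul, sub_zero] at hft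
    rw [← h 1 (right_mem_Icc.2 zero_le_one)] at hft
    rw [← hft]
    refine intervalIntegral.integral_congr_ae ?_
    filter_upwards [hKd.ae_hasDerivAt_integral, hK.ae_hasDerivAt_integral] with s h1 h2 hs
    have hs' := uIoc_subset_uIcc hs
    have hD := (h1 hs' 0 left_mem_uIcc).mul ((h2 hs' 0 left_mem_uIcc).neg.exp)
    simp only [Pi.neg_apply] at hD
    have := hD.deriv
    have hds := h s (by rwa [uIcc_of_le zero_le_one] at hs')
    rw [← hds] at this
    refine Eq.trans ?_ this.symm
    ring
  have hi : IntervalIntegrable (fun s => c * Real.exp (-κ s)) volume 0 1 := by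
    refine ContinuousOn.intervalIntegrable ?_
    rw [uIcc_of_le zero_le_one]
    exact continuousOn_const.mul (Real.continuous_exp.comp_continuousOn hκc.neg)
  have hM1 := abs_le.1 (hM 1 (right_mem_Icc.2 zero_le_one))
  have e1 : d 1 = (∫ s in (0 : ℝ)..1, c * Real.exp (-κ s)) * Real.exp (κ 1) := by
    rw [hw, mul_assoc, ← Real.exp_add, neg_add_cancel, Real.exp_zero, mul_one]
  have lo : c * Real.exp (-M) ≤ ∫ s in (0 : ℝ)..1, c * Real.exp (-κ s) := by
    have := intervalIntegral.integral_mono_on (zero_le_one' ℝ)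
      (intervalIntegrable_const (c := c * Real.exp (-M))) hi (fun s hs => by
        have := abs_le.1 (hM s hs)
        gcongr; exact this.2)
    simpa using this
  have up : ∫ s in (0 : ℝ)..1, c * Real.exp (-κ s) ≤ c * Real.exp M := by
    have := intervalIntegral.integral_mono_on (zero_le_one' ℝ) hi
      (intervalIntegrable_const (c := c * Real.exp M)) (fun s hs => by
        have := abs_le.1 (hM s hs)
        gcongr
        change -κ s ≤ M
        linarith [this.1])
    simpa using this
  rw [e1]
  constructor
  · calc c * Real.exp (-(2 * M)) = c * Real.exp (-M) * Real.exp (-M) := by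
          rw [mul_assoc, ← Real.exp_add]; congr 2; ring
      _ ≤ _ := mul_le_mul lo (Real.exp_le_exp.2 hM1.1) (Real.exp_pos _).le
          ((by positivity : 0 ≤ c * Real.exp (-M)).trans lo)
  · calc _ ≤ c * Real.exp M * Real.exp M := by
          refine mul_le_mul up (Real.exp_le_exp.2 hM1.2) (Real.exp_pos _).le (by positivity)
      _ = c * Real.exp (2 * M) := by
          rw [mul_assoc, ← Real.exp_add]; congr 2; ring

/-- `θ` is the Prüfer angle at the real spectral parameter `l`. -/
structure IsPruferAngle (q₁ q₂ : ℝ → ℝ) (l : ℝ) (θ : ℝ → ℝ) : Prop where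
  cont : Continuous θ
  eq : ∀ t ∈ Icc (0 : ℝ) 1,
    θ t = ∫ s in (0 : ℝ)..t, (l - q₁ s * Real.cos (2 * θ s) - q₂ s * Real.sin (2 * θ s))

theorem abs_cos_two_mul_sub_le (x y : ℝ) :
    |Real.cos (2 * x) - Real.cos (2 * y)| ≤ 2 * |x - y| := by
  have h : LipschitzWith 1 Real.cos := Real.lipschitzWith_cos
  have := h.dist_le_mul (2 * x) (2 * y)
  rw [Real.dist_eq, Real.dist_eq, ← mul_sub, abs_mul] at this
  simpa using this

theorem abs_sin_two_mul_sub_le (x y : ℝ) :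
    |Real.sin (2 * x) - Real.sin (2 * y)| ≤ 2 * |x - y| := by
  have h : LipschitzWith 1 Real.sin := Real.lipschitzWith_sin
  have := h.dist_le_mul (2 * x) (2 * y)
  rw [Real.dist_eq, Real.dist_eq, ← mul_sub, abs_mul] at this
  simpa using this

variable {q₁ q₂ : ℝ → ℝ}

theorem intervalIntegrable_prufer (h₁ : IntervalIntegrable q₁ volume 0 1)
    (h₂ : IntervalIntegrable q₂ volume 0 1) (l : ℝ) {θ : ℝ → ℝ} (hθ : Continuous θ) :
    IntervalIntegrable (fun s => l - q₁ s * Real.cos (2 * θ s) - q₂ s * Real.sin (2 * θ s))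
      volume 0 1 :=
  (intervalIntegrable_const.sub (h₁.mul_continuousOn (by fun_prop))).sub
    (h₂.mul_continuousOn (by fun_prop))

theorem exists_isPruferAngle (h₁ : IntervalIntegrable q₁ volume 0 1)
    (h₂ : IntervalIntegrable q₂ volume 0 1) (l : ℝ) : ∃ θ, IsPruferAngle q₁ q₂ l θ := by
  obtain ⟨θ, hθ, -, h⟩ := volterra_exists (E := ℝ)
    (F := fun t y => l - q₁ t * Real.cos (2 * y) - q₂ t * Real.sin (2 * y))
    (k := fun t => 2 * (|q₁ t| + |q₂ t|)) ((h₁.abs.add h₂.abs).const_mul 2)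
    (fun t _ => by positivity) (fun t _ x y => by
      have e : l - q₁ t * Real.cos (2 * x) - q₂ t * Real.sin (2 * x) -
          (l - q₁ t * Real.cos (2 * y) - q₂ t * Real.sin (2 * y)) =
          -(q₁ t * (Real.cos (2 * x) - Real.cos (2 * y)) +
            q₂ t * (Real.sin (2 * x) - Real.sin (2 * y))) := by ring
      rw [e, norm_neg]
      refine (norm_add_le _ _).trans ?_
      rw [norm_mul, norm_mul]
      simp only [Real.norm_eq_abs]
      nlinarith [abs_cos_two_mul_sub_le x y, abs_sin_two_mul_sub_le x y, abs_nonneg (q₁ t),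
        abs_nonneg (q₂ t),
        mul_le_mul_of_nonneg_left (abs_cos_two_mul_sub_le x y) (abs_nonneg (q₁ t)),
        mul_le_mul_of_nonneg_left (abs_sin_two_mul_sub_le x y) (abs_nonneg (q₂ t))])
    (fun v hv => intervalIntegrable_prufer h₁ h₂ l hv)
    (x₀ := fun _ => 0) continuousOn_const (C := fun _ => univ) (fun _ => isClosed_univ)
    (fun _ _ _ _ _ => mem_univ _) (v₀ := fun _ => 0) continuous_const (fun _ _ => mem_univ _)
  exact ⟨θ, hθ, fun t ht => by simpa using h t ht⟩

/-- The difference of two angles solves a linear equation with source `l' - l`. The lower bound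
yields strict monotonicity in `l`, the upper one continuity. -/
theorem IsPruferAngle.bounds (h₁ : IntervalIntegrable q₁ volume 0 1)
    (h₂ : IntervalIntegrable q₂ volume 0 1) {l l' : ℝ} {θ θ' : ℝ → ℝ}
    (h : IsPruferAngle q₁ q₂ l θ) (h' : IsPruferAngle q₁ q₂ l' θ') (hl : l ≤ l') {M : ℝ}
    (hM : M = ∫ s in (0 : ℝ)..1, 2 * (|q₁ s| + |q₂ s|)) :
    (l' - l) * Real.exp (-(2 * M)) ≤ θ' 1 - θ 1 ∧
      θ' 1 - θ 1 ≤ (l' - l) * Real.exp (2 * M) := by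
  set N : ℝ → ℝ := fun s => -(q₁ s * (Real.cos (2 * θ' s) - Real.cos (2 * θ s)) +
            q₂ s * (Real.sin (2 * θ' s) - Real.sin (2 * θ s))) with hN
  -- The difference quotient of the nonlinearity. Where the angles coincide the inverse is `0` by
  -- convention, which is harmless since `N` vanishes there too.
  set K : ℝ → ℝ := fun s => N s * (θ' s - θ s)⁻¹ with hKdef
  have hk : IntervalIntegrable (fun s => 2 * (|q₁ s| + |q₂ s|)) volume 0 1 :=
    (h₁.abs.add h₂.abs).const_mul 2
  have hNi : IntervalIntegrable N volume 0 1 :=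
    ((h₁.mul_continuousOn (by have := h.cont; have := h'.cont; fun_prop)).add
      (h₂.mul_continuousOn (by have := h.cont; have := h'.cont; fun_prop))).neg
  have hNb : ∀ s, |N s| ≤ 2 * (|q₁ s| + |q₂ s|) * |θ' s - θ s| := by
    intro s
    rw [hN]
    simp only [abs_neg]
    refine (abs_add_le _ _).trans ?_
    rw [abs_mul, abs_mul]
    nlinarith [mul_le_mul_of_nonneg_left (abs_cos_two_mul_sub_le (θ' s) (θ s))
      (abs_nonneg (q₁ s)), mul_le_mul_of_nonneg_left (abs_sin_two_mul_sub_le (θ' s) (θ s))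
      (abs_nonneg (q₂ s))]
  have hKb : ∀ s, ‖K s‖ ≤ 2 * (|q₁ s| + |q₂ s|) := by
    intro s
    rw [hKdef]
    simp only [Real.norm_eq_abs, abs_mul, abs_inv]
    by_cases h0 : θ' s - θ s = 0
    · rw [h0]; simp only [abs_zero, inv_zero, mul_zero]; positivity
    · rw [← div_eq_mul_inv, div_le_iff₀ (abs_pos.2 h0)]
      exact hNb s
  have hKN : ∀ s, K s * (θ' s - θ s) = N s := by
    intro s
    by_cases h0 : θ' s - θ s = 0
    · have := hNb s
      rw [h0] at this ⊢
      simp only [abs_zero, mul_zero] at this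
      rw [mul_zero, abs_eq_zero.1 (le_antisymm this (abs_nonneg _))]
    · rw [hKdef]; simp only; rw [inv_mul_cancel_right₀ h0]
  have hKi : IntervalIntegrable K volume 0 1 := by
    rw [intervalIntegrable_iff]
    refine Integrable.mono' (intervalIntegrable_iff.1 hk) ?_ (Filter.Eventually.of_forall hKb)
    exact (intervalIntegrable_iff.1 hNi).aestronglyMeasurable.mul
      ((h'.cont.sub h.cont).measurable.inv.aestronglyMeasurable)
  refine volterra_linear_bounds (d := fun s => θ' s - θ s) (K := K) (sub_nonneg.2 hl)
    (h'.cont.sub h.cont) hKi (fun t ht => ?_) (fun t ht => ?_)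
  · have hsub : uIcc 0 t ⊆ uIcc (0 : ℝ) 1 :=
      uIcc_subset_uIcc left_mem_uIcc (by rwa [uIcc_of_le zero_le_one])
    have h1 := intervalIntegral.norm_integral_le_of_norm_le ht.1
      (Filter.Eventually.of_forall fun s _ => hKb s) (hk.mono_set hsub)
    refine h1.trans ?_
    rw [hM]
    refine intervalIntegral.integral_mono_interval le_rfl ht.1 ht.2
      (Filter.Eventually.of_forall fun s => ?_) hk
    simp only [Pi.zero_apply]; positivity
  · have hsub : uIcc 0 t ⊆ uIcc (0 : ℝ) 1 :=
      uIcc_subset_uIcc left_mem_uIcc (by rwa [uIcc_of_le zero_le_one])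
    simp only [hKN]
    rw [h'.eq t ht, h.eq t ht, ← intervalIntegral.integral_sub
      ((intervalIntegrable_prufer h₁ h₂ l' h'.cont).mono_set hsub)
      ((intervalIntegrable_prufer h₁ h₂ l h.cont).mono_set hsub)]
    refine intervalIntegral.integral_congr fun s _ => ?_
    simp only [hN]; ring

theorem IsPruferAngle.abs_sub_le (h₁ : IntervalIntegrable q₁ volume 0 1)
    (h₂ : IntervalIntegrable q₂ volume 0 1) {l : ℝ} {θ : ℝ → ℝ}
    (h : IsPruferAngle q₁ q₂ l θ) : |θ 1 - l| ≤ ∫ s in (0 : ℝ)..1, (|q₁ s| + |q₂ s|) := by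
  have e : θ 1 - l = ∫ s in (0 : ℝ)..1,
      (l - q₁ s * Real.cos (2 * θ s) - q₂ s * Real.sin (2 * θ s) - l) := by
    rw [intervalIntegral.integral_sub (intervalIntegrable_prufer h₁ h₂ l h.cont)
      intervalIntegrable_const, ← h.eq 1 (right_mem_Icc.2 zero_le_one)]
    simp
  rw [e]
  rw [← Real.norm_eq_abs]
  refine intervalIntegral.norm_integral_le_of_norm_le zero_le_one
    (Filter.Eventually.of_forall fun s _ => ?_) (h₁.abs.add h₂.abs)
  have e2 : l - q₁ s * Real.cos (2 * θ s) - q₂ s * Real.sin (2 * θ s) - l =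
    -(q₁ s * Real.cos (2 * θ s) + q₂ s * Real.sin (2 * θ s)) := by ring
  rw [e2, norm_neg]
  refine (norm_add_le _ _).trans ?_
  rw [norm_mul, norm_mul]
  simp only [Real.norm_eq_abs]
  nlinarith [mul_le_mul_of_nonneg_left (Real.abs_cos_le_one (2 * θ s)) (abs_nonneg (q₁ s)),
    mul_le_mul_of_nonneg_left (Real.abs_sin_le_one (2 * θ s)) (abs_nonneg (q₂ s))]

/-- A choice of Prüfer angle for every real spectral parameter, and its value at `1` as a
strictly increasing bijection of the real line. -/
theorem exists_pruferAngle_family (h₁ : IntervalIntegrable q₁ volume 0 1)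
    (h₂ : IntervalIntegrable q₂ volume 0 1) :
    ∃ θ : ℝ → ℝ → ℝ, (∀ l, IsPruferAngle q₁ q₂ l (θ l)) ∧ StrictMono (fun l => θ l 1) ∧
      Function.Surjective (fun l => θ l 1) := by
  choose θ hθ using exists_isPruferAngle h₁ h₂
  set M := ∫ s in (0 : ℝ)..1, 2 * (|q₁ s| + |q₂ s|) with hM
  have hmono : StrictMono (fun l => θ l 1) := by
    intro l l' hl
    have := ((hθ l).bounds h₁ h₂ (hθ l') hl.le hM).1
    have h2 : 0 < (l' - l) * Real.exp (-(2 * M)) := mul_pos (sub_pos.2 hl) (Real.exp_pos _)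
    simp only; linarith
  refine ⟨θ, hθ, hmono, ?_⟩
  have hlip : LipschitzWith (Real.exp (2 * M)).toNNReal (fun l => θ l 1) := by
    refine LipschitzWith.of_dist_le_mul fun l l' => ?_
    rw [Real.coe_toNNReal _ (Real.exp_pos _).le, Real.dist_eq, Real.dist_eq]
    wlog hl : l' ≤ l generalizing l l'
    · rw [abs_sub_comm, abs_sub_comm l]
      exact this l' l (le_of_not_ge hl)
    rw [abs_of_nonneg (sub_nonneg.2 hl), abs_of_nonneg (sub_nonneg.2 (hmono.monotone hl)),
      mul_comm]
    exact ((hθ l').bounds h₁ h₂ (hθ l) hl hM).2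
  refine hlip.continuous.surjective ?_ ?_
  · refine Filter.tendsto_atTop_mono (f := fun l => l - ∫ s in (0 : ℝ)..1, (|q₁ s| + |q₂ s|))
      (fun l => ?_) (Filter.tendsto_atTop_add_const_right _ _ Filter.tendsto_id)
    have := abs_le.1 ((hθ l).abs_sub_le h₁ h₂)
    linarith [this.1]
  · refine Filter.tendsto_atBot_mono (f := fun l => l + ∫ s in (0 : ℝ)..1, (|q₁ s| + |q₂ s|))
      (fun l => ?_) (Filter.tendsto_atBot_add_const_right _ _ Filter.tendsto_id)
    have := abs_le.1 ((hθ l).abs_sub_le h₁ h₂)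
    linarith [this.2]

end

/-! ### The first order system, its uniqueness theorem and the Prüfer solution -/

section

/-- `v` solves the first order system equivalent to `ℓ_Q v = z v`. -/
structure IsSolution (q₁ q₂ : ℝ → ℝ) (z : ℂ) (v : Fin 2 → ℝ → ℂ) : Prop where
  ac : ∀ k, AbsolutelyContinuousOnInterval (v k) 0 1
  fst : ∀ᵐ x ∂mu01, HasDerivAt (v 0) (q₂ x * v 0 x - (q₁ x + z) * v 1 x) x
  snd : ∀ᵐ x ∂mu01, HasDerivAt (v 1) ((z - q₁ x) * v 0 x - q₂ x * v 1 x) x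

variable {q₁ q₂ : ℝ → ℝ} {z : ℂ}

theorem ell_zero (v : Fin 2 → ℝ → ℂ) (x : ℝ) :
    ell q₁ q₂ v x 0 = deriv (v 1) x + (q₁ x * v 0 x + q₂ x * v 1 x) := by
  simp [ell, B, Q]
  rfl

theorem ell_one (v : Fin 2 → ℝ → ℂ) (x : ℝ) :
    ell q₁ q₂ v x 1 = -deriv (v 0) x + (q₂ x * v 0 x - q₁ x * v 1 x) := by
  simp [ell, B, Q, sub_eq_add_neg]
  rfl

theorem isSolution_of_ell {v : Fin 2 → ℝ → ℂ}
    (hv : ∀ k, AbsolutelyContinuousOnInterval (v k) 0 1)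
    (h : ∀ k, ∀ᵐ x ∂mu01, ell q₁ q₂ v x k = z * v k x) : IsSolution q₁ q₂ z v := by
  refine ⟨hv, ?_, ?_⟩
  · filter_upwards [h 1, ac_ae_differentiableAt (hv 0)] with x hx hd
    rw [ell_one] at hx
    convert! hd.hasDerivAt using 1
    linear_combination hx
  · filter_upwards [h 0, ac_ae_differentiableAt (hv 1)] with x hx hd
    rw [ell_zero] at hx
    convert! hd.hasDerivAt using 1
    linear_combination -hx

theorem IsSolution.ell_eq {v : Fin 2 → ℝ → ℂ} (h : IsSolution q₁ q₂ z v) (k : Fin 2) :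
    ∀ᵐ x ∂mu01, ell q₁ q₂ v x k = z * v k x := by
  filter_upwards [h.fst, h.snd] with x h0 h1
  fin_cases k
  · simp only [Fin.zero_eta]
    rw [ell_zero, h1.deriv]; ring
  · simp only [Fin.mk_one]
    rw [ell_one, h0.deriv]; ring

theorem IsSolution.const_mul {v : Fin 2 → ℝ → ℂ} (h : IsSolution q₁ q₂ z v) (c : ℂ) :
    IsSolution q₁ q₂ z (fun k x => c * v k x) := by
  refine ⟨fun k => (h.ac k).const_smul c, ?_, ?_⟩
  · filter_upwards [h.fst] with x hx
    convert! hx.const_mul c using 1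
    ring
  · filter_upwards [h.snd] with x hx
    convert! hx.const_mul c using 1
    ring

/-- Both solve the same Volterra equation in `ℂ × ℂ`, whose Lipschitz constant `2(|q₁| + |q₂| +
‖z‖)` is integrable. -/
theorem IsSolution.eqOn_of_initial (h₁ : IntervalIntegrable q₁ volume 0 1)
    (h₂ : IntervalIntegrable q₂ volume 0 1) {v w : Fin 2 → ℝ → ℂ}
    (hv : IsSolution q₁ q₂ z v) (hw : IsSolution q₁ q₂ z w) (h0 : ∀ k, v k 0 = w k 0) (k : Fin 2) :
    ∀ x ∈ Icc (0 : ℝ) 1, v k x = w k x := by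
  let F : ℝ → ℂ × ℂ → ℂ × ℂ := fun t y =>
    (q₂ t * y.1 - (q₁ t + z) * y.2, (z - q₁ t) * y.1 - q₂ t * y.2)
  have hii : ∀ v : Fin 2 → ℝ → ℂ, IsSolution q₁ q₂ z v →
      IntervalIntegrable (fun s => F s (v 0 s, v 1 s)) volume 0 1 ∧
      ∀ t ∈ Icc (0 : ℝ) 1, (v 0 t, v 1 t) = (v 0 0, v 1 0) +
        ∫ s in (0 : ℝ)..t, F s (v 0 s, v 1 s) := by
    intro v hv
    obtain ⟨i0, e0⟩ := (hv.ac 0).ftc_complex zero_le_one hv.fst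
    obtain ⟨i1, e1⟩ := (hv.ac 1).ftc_complex zero_le_one hv.snd
    have hi : IntervalIntegrable (fun s => F s (v 0 s, v 1 s)) volume 0 1 :=
      ⟨i0.1.prodMk i1.1, i0.2.prodMk i1.2⟩
    refine ⟨hi, fun t ht => ?_⟩
    have hsub : uIcc 0 t ⊆ uIcc (0 : ℝ) 1 :=
      uIcc_subset_uIcc left_mem_uIcc (by rwa [uIcc_of_le zero_le_one])
    have := integral_pair (i0.mono_set hsub).1 (i1.mono_set hsub).1
    rw [intervalIntegral.integral_of_le ht.1]
    refine (Prod.ext ?_ ?_ : _)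
    · simp only [Prod.fst_add]
      rw [e0 t ht, intervalIntegral.integral_of_le ht.1]
      exact congrArg _ (congrArg Prod.fst this).symm
    · simp only [Prod.snd_add]
      rw [e1 t ht, intervalIntegral.integral_of_le ht.1]
      exact congrArg _ (congrArg Prod.snd this).symm
  have hc : ∀ v : Fin 2 → ℝ → ℂ, IsSolution q₁ q₂ z v →
      ContinuousOn (fun t => (v 0 t, v 1 t)) (Icc 0 1) := by
    intro v hv
    have a := (hv.ac 0).continuousOn
    have b := (hv.ac 1).continuousOn
    rw [uIcc_of_le zero_le_one] at a b
    exact a.prodMk b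
  have hk : IntervalIntegrable (fun t => 2 * (|q₁ t| + |q₂ t| + ‖z‖)) volume 0 1 :=
    ((h₁.abs.add h₂.abs).add intervalIntegrable_const).const_mul 2
  have hF : ∀ t ∈ Icc (0 : ℝ) 1, ∀ x y : ℂ × ℂ,
      ‖F t x - F t y‖ ≤ (2 * (|q₁ t| + |q₂ t| + ‖z‖)) * ‖x - y‖ := by
    intro t _ x y
    have n1 : ‖(x - y).1‖ ≤ ‖x - y‖ := norm_fst_le _
    have n2 : ‖(x - y).2‖ ≤ ‖x - y‖ := norm_snd_le _
    have hq1 : ‖(q₁ t : ℂ)‖ = |q₁ t| := by simp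
    have hq2 : ‖(q₂ t : ℂ)‖ = |q₂ t| := by simp
    have b1 : ‖(q₁ t : ℂ) + z‖ ≤ |q₁ t| + ‖z‖ := hq1 ▸ norm_add_le _ _
    have b2 : ‖z - (q₁ t : ℂ)‖ ≤ |q₁ t| + ‖z‖ := by
      rw [← hq1, add_comm]; exact norm_sub_le _ _
    have p0 := norm_nonneg (x - y)
    have p1 := abs_nonneg (q₁ t)
    have p2 := abs_nonneg (q₂ t)
    have p3 := norm_nonneg z
    rw [Prod.norm_def]
    refine max_le ?_ ?_
    · have e : (F t x - F t y).1 = q₂ t * (x - y).1 - (q₁ t + z) * (x - y).2 := by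
        simp only [F, Prod.fst_sub, Prod.snd_sub]; ring
      rw [e]
      refine (norm_sub_le _ _).trans ?_
      rw [norm_mul, norm_mul, hq2]
      have m1 := mul_le_mul_of_nonneg_left n1 p2
      have m2 := mul_le_mul b1 n2 (norm_nonneg _) (by positivity)
      nlinarith [mul_nonneg p0 p1, mul_nonneg p0 p2, mul_nonneg p0 p3]
    · have e : (F t x - F t y).2 = (z - q₁ t) * (x - y).1 - q₂ t * (x - y).2 := by
        simp only [F, Prod.fst_sub, Prod.snd_sub]; ring
      rw [e]
      refine (norm_sub_le _ _).trans ?_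
      rw [norm_mul, norm_mul, hq2]
      have m1 := mul_le_mul_of_nonneg_left n2 p2
      have m2 := mul_le_mul b2 n1 (norm_nonneg _) (by positivity)
      nlinarith [mul_nonneg p0 p1, mul_nonneg p0 p2, mul_nonneg p0 p3]
  have key := volterra_unique hk (fun t _ => by positivity) hF (x₀ := fun _ => (v 0 0, v 1 0))
    (hii v hv).1 (hii w hw).1 (hc v hv) (hc w hw) (hii v hv).2
    (by rw [h0 0, h0 1]; exact (hii w hw).2)
  intro x hx
  have := key x hx
  fin_cases k
  · exact congrArg Prod.fst this
  · exact congrArg Prod.snd this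

/-- Lagrange identity: nontrivial solutions with selfadjoint boundary conditions exist only for
real spectral parameters. -/
theorem IsSolution.im_eq_zero {v : Fin 2 → ℝ → ℂ} (hv : IsSolution q₁ q₂ z v) (hl : v 1 0 = 0)
    {j : Fin 2} (hr : v j 1 = 0) {x₀ : ℝ} (hx₀ : x₀ ∈ Icc (0 : ℝ) 1) {k : Fin 2}
    (hne : v k x₀ ≠ 0) : z.im = 0 := by
  have hstar : ∀ k, AbsolutelyContinuousOnInterval (fun x => (starRingEnd ℂ) (v k x)) 0 1 :=
    fun k => (hv.ac k).comp_contDiff (φ := fun y => (starRingEnd ℂ) y) Complex.conjCLE.contDiff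
  -- The Wronskian of `v` with its conjugate has derivative `(z - conj z)(|v₁|² + |v₂|²)` and
  -- vanishes at both endpoints by the boundary conditions.
  have hac := ((hv.ac 1).smul (hstar 0)).sub ((hv.ac 0).smul (hstar 1))
  obtain ⟨-, h⟩ := hac.ftc_complex zero_le_one
    (g := fun x => (z - (starRingEnd ℂ) z) * ((‖v 0 x‖ ^ 2 + ‖v 1 x‖ ^ 2 : ℝ) : ℂ)) (by
      filter_upwards [hv.fst, hv.snd] with x h0 h1
      have c : ∀ k d, HasDerivAt (v k) d x →
          HasDerivAt (fun x => (starRingEnd ℂ) (v k x)) ((starRingEnd ℂ) d) x := fun k d hd =>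
        (Complex.conjCLE.hasFDerivAt (x := v k x)).comp_hasDerivAt x hd
      convert! (h1.mul (c 0 _ h0)).sub (h0.mul (c 1 _ h1)) using 1
      push_cast
      rw [← Complex.mul_conj', ← Complex.mul_conj']
      simp only [map_sub, map_mul, map_add, Complex.conj_ofReal]
      ring)
  have h1 := h 1 (right_mem_Icc.2 zero_le_one)
  have e1 : v 1 1 * (starRingEnd ℂ) (v 0 1) - v 0 1 * (starRingEnd ℂ) (v 1 1) = 0 := by
    fin_cases j
    · simp only [Fin.zero_eta] at hr; simp [hr]
    · simp only [Fin.mk_one] at hr; simp [hr]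
  change v 1 1 * (starRingEnd ℂ) (v 0 1) - v 0 1 * (starRingEnd ℂ) (v 1 1) =
    v 1 0 * (starRingEnd ℂ) (v 0 0) - v 0 0 * (starRingEnd ℂ) (v 1 0) + _ at h1
  rw [e1, hl, map_zero, mul_zero, zero_mul, sub_zero, zero_add] at h1
  rw [intervalIntegral.integral_const_mul, intervalIntegral.integral_ofReal] at h1
  have cont : ∀ k, ContinuousOn (v k) (Icc 0 1) := fun k => by
    have := (hv.ac k).continuousOn
    rwa [uIcc_of_le zero_le_one] at this
  have hpos : 0 < ∫ x in (0 : ℝ)..1, (‖v 0 x‖ ^ 2 + ‖v 1 x‖ ^ 2) := by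
    refine intervalIntegral.integral_pos zero_lt_one
      (((cont 0).norm.pow 2).add ((cont 1).norm.pow 2)) (fun x _ => by positivity)
      ⟨x₀, hx₀, ?_⟩
    have : 0 < ‖v k x₀‖ ^ 2 := by positivity
    fin_cases k
    · simp only [Fin.zero_eta] at this; positivity
    · simp only [Fin.mk_one] at this; positivity
  rcases mul_eq_zero.1 h1.symm with h2 | h2
  · rw [sub_eq_zero] at h2
    exact Complex.conj_eq_iff_im.1 h2.symm
  · exact absurd (by exact_mod_cast h2) hpos.ne'

/-- The logarithm of the Prüfer radius. -/
def logRadius (q₁ q₂ θ : ℝ → ℝ) (x : ℝ) : ℝ :=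
  ∫ s in (0 : ℝ)..x, (q₂ s * Real.cos (2 * θ s) - q₁ s * Real.sin (2 * θ s))

/-- The solution of the system with Prüfer angle `θ`. -/
def pruferSolution (q₁ q₂ θ : ℝ → ℝ) : Fin 2 → ℝ → ℂ :=
  ![fun x => (Real.exp (logRadius q₁ q₂ θ x) * Real.cos (θ x) : ℝ),
    fun x => (Real.exp (logRadius q₁ q₂ θ x) * Real.sin (θ x) : ℝ)]

theorem intervalIntegrable_logRadius (h₁ : IntervalIntegrable q₁ volume 0 1)
    (h₂ : IntervalIntegrable q₂ volume 0 1) {θ : ℝ → ℝ} (hθ : Continuous θ) :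
    IntervalIntegrable (fun s => q₂ s * Real.cos (2 * θ s) - q₁ s * Real.sin (2 * θ s))
      volume 0 1 :=
  (h₂.mul_continuousOn (by fun_prop)).sub (h₁.mul_continuousOn (by fun_prop))

theorem IsPruferAngle.ac (h₁ : IntervalIntegrable q₁ volume 0 1)
    (h₂ : IntervalIntegrable q₂ volume 0 1) {l : ℝ} {θ : ℝ → ℝ} (h : IsPruferAngle q₁ q₂ l θ) :
    AbsolutelyContinuousOnInterval θ 0 1 := by
  have := (intervalIntegrable_prufer h₁ h₂ l
    h.cont).absolutelyContinuousOnInterval_intervalIntegral left_mem_uIcc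
  refine (absolutelyContinuousOnInterval_iff _ _ _).2 fun ε hε => ?_
  obtain ⟨δ, hδ, H⟩ := (absolutelyContinuousOnInterval_iff _ _ _).1 this ε hε
  refine ⟨δ, hδ, fun E hE hE' => ?_⟩
  refine lt_of_eq_of_lt (Finset.sum_congr rfl fun i hi => ?_) (H E hE hE')
  have := hE.1 i hi
  rw [uIcc_of_le zero_le_one] at this
  rw [h.eq _ this.1, h.eq _ this.2]

theorem ae_mu01_of_ae_uIcc {P : ℝ → Prop} (h : ∀ᵐ x, x ∈ uIcc (0 : ℝ) 1 → P x) :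
    ∀ᵐ x ∂mu01, P x := by
  rw [ae_restrict_iff' measurableSet_Ioo]
  filter_upwards [h] with x hx hx'
  exact hx (by rw [uIcc_of_le zero_le_one]; exact Ioo_subset_Icc_self hx')

theorem IsPruferAngle.ae_hasDerivAt (h₁ : IntervalIntegrable q₁ volume 0 1)
    (h₂ : IntervalIntegrable q₂ volume 0 1) {l : ℝ} {θ : ℝ → ℝ} (h : IsPruferAngle q₁ q₂ l θ) :
    ∀ᵐ x ∂mu01, HasDerivAt θ
      (l - q₁ x * Real.cos (2 * θ x) - q₂ x * Real.sin (2 * θ x)) x := by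
  filter_upwards [ae_mu01_of_ae_uIcc
    (intervalIntegrable_prufer h₁ h₂ l h.cont).ae_hasDerivAt_integral,
    ae_restrict_mem measurableSet_Ioo] with x hx hx'
  refine (hx 0 left_mem_uIcc).congr_of_eventuallyEq ?_
  filter_upwards [isOpen_Ioo.mem_nhds hx'] with y hy
  exact h.eq y (Ioo_subset_Icc_self hy)

theorem ae_hasDerivAt_logRadius (h₁ : IntervalIntegrable q₁ volume 0 1)
    (h₂ : IntervalIntegrable q₂ volume 0 1) {θ : ℝ → ℝ} (hθ : Continuous θ) :
    ∀ᵐ x ∂mu01, HasDerivAt (logRadius q₁ q₂ θ)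
      (q₂ x * Real.cos (2 * θ x) - q₁ x * Real.sin (2 * θ x)) x := by
  filter_upwards [ae_mu01_of_ae_uIcc
    (intervalIntegrable_logRadius h₁ h₂ hθ).ae_hasDerivAt_integral] with x hx
  exact hx 0 left_mem_uIcc

/-- The double angle formulas turn the equations for the angle and the logarithmic radius into the
two components of the system. -/
theorem IsPruferAngle.isSolution (h₁ : IntervalIntegrable q₁ volume 0 1)
    (h₂ : IntervalIntegrable q₂ volume 0 1) {l : ℝ} {θ : ℝ → ℝ} (h : IsPruferAngle q₁ q₂ l θ) :
    IsSolution q₁ q₂ l (pruferSolution q₁ q₂ θ) := by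
  have hR := (intervalIntegrable_logRadius h₁ h₂
    h.cont).absolutelyContinuousOnInterval_intervalIntegral left_mem_uIcc
  have hE := hR.comp_contDiff (φ := Real.exp) Real.contDiff_exp
  have hθ := h.ac h₁ h₂
  refine ⟨fun k => ?_, ?_, ?_⟩
  · fin_cases k
    · exact (hE.mul (hθ.comp_contDiff (φ := Real.cos) Real.contDiff_cos)).comp_contDiff
        (φ := fun y : ℝ => (y : ℂ)) Complex.ofRealCLM.contDiff
    · exact (hE.mul (hθ.comp_contDiff (φ := Real.sin) Real.contDiff_sin)).comp_contDiff
        (φ := fun y : ℝ => (y : ℂ)) Complex.ofRealCLM.contDiff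
  · filter_upwards [h.ae_hasDerivAt h₁ h₂, ae_hasDerivAt_logRadius h₁ h₂ h.cont] with x a b
    have := (b.exp.mul a.cos).ofReal_comp
    simp only [pruferSolution, Matrix.cons_val_zero, Matrix.cons_val_one]
    convert! this using 1
    norm_cast
    rw [Real.cos_two_mul, Real.sin_two_mul]
    have := Real.sin_sq_add_cos_sq (θ x)
    linear_combination (Real.exp (logRadius q₁ q₂ θ x) * Real.cos (θ x) * q₂ x * (-2)) * this
  · filter_upwards [h.ae_hasDerivAt h₁ h₂, ae_hasDerivAt_logRadius h₁ h₂ h.cont] with x a b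
    have := (b.exp.mul a.sin).ofReal_comp
    simp only [pruferSolution, Matrix.cons_val_zero, Matrix.cons_val_one]
    convert! this using 1
    norm_cast
    rw [Real.cos_two_mul, Real.sin_two_mul]
    have := Real.sin_sq_add_cos_sq (θ x)
    linear_combination (q₁ x * Real.exp (logRadius q₁ q₂ θ x) * Real.cos (θ x) * 2) * this

theorem IsPruferAngle.initial {l : ℝ} {θ : ℝ → ℝ} (h : IsPruferAngle q₁ q₂ l θ) :
    θ 0 = 0 := by
  simpa using h.eq 0 (left_mem_Icc.2 zero_le_one)

end

/-! ### Eigenvalues as boundary zeros of the Prüfer angle -/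

section

variable {q₁ q₂ : ℝ → ℝ} {z : ℂ}

theorem memLp_two_of_continuousOn {f : ℝ → ℂ} (hf : ContinuousOn f (Icc 0 1)) :
    MemLp f 2 mu01 := by
  obtain ⟨C, hC⟩ := isCompact_Icc.exists_bound_of_continuousOn hf
  refine MemLp.of_bound ((hf.mono Ioo_subset_Icc_self).aestronglyMeasurable measurableSet_Ioo) C ?_
  filter_upwards [ae_restrict_mem measurableSet_Ioo] with x hx
  exact hC x (Ioo_subset_Icc_self hx)

theorem IsSolution.continuousOn {v : Fin 2 → ℝ → ℂ} (h : IsSolution q₁ q₂ z v) (k : Fin 2) :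
    ContinuousOn (v k) (Icc 0 1) := by
  have := (h.ac k).continuousOn
  rwa [uIcc_of_le zero_le_one] at this

/-- The element of the Hilbert space defined by a solution. -/
def IsSolution.toH {v : Fin 2 → ℝ → ℂ} (h : IsSolution q₁ q₂ z v) : H :=
  WithLp.toLp 2 fun k => (memLp_two_of_continuousOn (h.continuousOn k)).toLp (v k)

theorem IsSolution.toH_ae {v : Fin 2 → ℝ → ℂ} (h : IsSolution q₁ q₂ z v) (k : Fin 2) :
    h.toH k =ᵐ[mu01] v k :=
  MemLp.coeFn_toLp (memLp_two_of_continuousOn (h.continuousOn k))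

theorem exists_isSolution_of_apply_eq {j : Fin 2} (w : (diracOp q₁ q₂ j).domain)
    (hw : diracOp q₁ q₂ j w = z • (w : H)) :
    ∃ v, IsSolution q₁ q₂ z v ∧ v 1 0 = 0 ∧ v j 1 = 0 ∧ ∀ k, (w : H) k =ᵐ[mu01] v k := by
  have hg : ((w : H), diracOp q₁ q₂ j w) ∈ graph q₁ q₂ j := by
    rw [← graph_diracOp]; exact LinearPMap.mem_graph _ w
  obtain ⟨v, hv, hu, hl⟩ := hg
  refine ⟨v, isSolution_of_ell hv.ac fun k => ?_, hv.left, hv.right, hu⟩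
  filter_upwards [hl k, hu k, Lp.coeFn_smul z ((w : H) k)] with x h1 h2 h3
  rw [← h1, ← h2, hw]
  exact h3

theorem IsSolution.exists_eigenvector {j : Fin 2} {v : Fin 2 → ℝ → ℂ}
    (h : IsSolution q₁ q₂ z v) (hl : v 1 0 = 0) (hr : v j 1 = 0) :
    ∃ w : (diracOp q₁ q₂ j).domain, (w : H) = h.toH ∧ diracOp q₁ q₂ j w = z • (w : H) := by
  have hg : (h.toH, z • h.toH) ∈ (diracOp q₁ q₂ j).graph := by
    rw [graph_diracOp]
    refine ⟨v, ⟨h.ac, hl, hr⟩, h.toH_ae, fun k => ?_⟩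
    filter_upwards [h.ell_eq k, h.toH_ae k, Lp.coeFn_smul z (h.toH k)] with x h1 h2 h3
    rw [h1, ← h2]
    exact h3
  obtain ⟨w, h1, h2⟩ := (LinearPMap.mem_graph_iff _).1 hg
  simp only at h1 h2
  exact ⟨w, h1, by rw [h2, h1]⟩

theorem pruferSolution_zero_zero {l : ℝ} {θ : ℝ → ℝ} (h : IsPruferAngle q₁ q₂ l θ) :
    pruferSolution q₁ q₂ θ 0 0 = 1 := by
  simp [pruferSolution, logRadius, h.initial]

theorem pruferSolution_one_zero {l : ℝ} {θ : ℝ → ℝ} (h : IsPruferAngle q₁ q₂ l θ) :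
    pruferSolution q₁ q₂ θ 1 0 = 0 := by
  simp [pruferSolution, logRadius, h.initial]

theorem IsSolution.eq_mul_pruferSolution (h₁ : IntervalIntegrable q₁ volume 0 1)
    (h₂ : IntervalIntegrable q₂ volume 0 1) {l : ℝ} {θ : ℝ → ℝ} (h : IsPruferAngle q₁ q₂ l θ)
    {v : Fin 2 → ℝ → ℂ} (hv : IsSolution q₁ q₂ l v) (hl : v 1 0 = 0) (k : Fin 2) :
    ∀ x ∈ Icc (0 : ℝ) 1, v k x = v 0 0 * pruferSolution q₁ q₂ θ k x := by
  refine hv.eqOn_of_initial h₁ h₂ ((h.isSolution h₁ h₂).const_mul (v 0 0)) (fun k => ?_) k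
  fin_cases k
  · simp [pruferSolution_zero_zero h]
  · simp [pruferSolution_one_zero h, hl]

theorem toH_pruferSolution_ne_zero (h₁ : IntervalIntegrable q₁ volume 0 1)
    (h₂ : IntervalIntegrable q₂ volume 0 1) {l : ℝ} {θ : ℝ → ℝ} (h : IsPruferAngle q₁ q₂ l θ) :
    (h.isSolution h₁ h₂).toH ≠ 0 := by
  intro h0
  have hs := h.isSolution h₁ h₂
  have hae : pruferSolution q₁ q₂ θ 0 =ᵐ[mu01] fun _ => 0 := by
    have h1 := hs.toH_ae 0
    rw [h0] at h1
    exact h1.symm.trans (Lp.coeFn_zero ℂ 2 mu01)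
  have heq := Measure.eqOn_Icc_of_ae_eq (volume : Measure ℝ) (zero_ne_one (α := ℝ))
    (f := pruferSolution q₁ q₂ θ 0) (g := fun _ => 0)
    (by rwa [Measure.restrict_congr_set Ioo_ae_eq_Icc.symm]) (hs.continuousOn 0) continuousOn_const
  have := heq (left_mem_Icc.2 zero_le_one)
  rw [pruferSolution_zero_zero h] at this
  exact one_ne_zero this

/-- The boundary phase function: `cos` for `j = 0`, `sin` for `j = 1`. -/
def boundaryFun (j : Fin 2) : ℝ → ℝ := ![Real.cos, Real.sin] j

theorem pruferSolution_apply_one_eq_zero_iff {θ : ℝ → ℝ} (j : Fin 2) :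
    pruferSolution q₁ q₂ θ j 1 = 0 ↔ boundaryFun j (θ 1) = 0 := by
  fin_cases j
  · simp [pruferSolution, boundaryFun, -Complex.ofReal_cos]
  · simp [pruferSolution, boundaryFun, -Complex.ofReal_sin]

/-- With `v₂(0) = 0` only `v₁(0)` is free, so uniqueness makes every eigenvector the multiple `c =
v₁(0)` of the Prüfer solution. The second conclusion is its condition at `1`. -/
theorem eigenspace_eq_span (h₁ : IntervalIntegrable q₁ volume 0 1)
    (h₂ : IntervalIntegrable q₂ volume 0 1) {l : ℝ} {θ : ℝ → ℝ} (h : IsPruferAngle q₁ q₂ l θ)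
    {j : Fin 2} (w : (diracOp q₁ q₂ j).domain) (hw : diracOp q₁ q₂ j w = (l : ℂ) • (w : H)) :
    ∃ c : ℂ, (w : H) = c • (h.isSolution h₁ h₂).toH ∧
      c * pruferSolution q₁ q₂ θ j 1 = 0 := by
  obtain ⟨v, hv, hl, hr, hae⟩ := exists_isSolution_of_apply_eq w hw
  have key := fun k => hv.eq_mul_pruferSolution h₁ h₂ h hl k
  refine ⟨v 0 0, ?_, ?_⟩
  · ext k : 1
    apply Lp.ext
    filter_upwards [hae k, (h.isSolution h₁ h₂).toH_ae k,
      Lp.coeFn_smul (v 0 0) ((h.isSolution h₁ h₂).toH k),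
      ae_restrict_mem measurableSet_Ioo] with x a1 a2 a3 a4
    rw [a1, key k x (Ioo_subset_Icc_self a4), ← a2]
    exact a3.symm
  · rw [← key j 1 (right_mem_Icc.2 zero_le_one), hr]

/-- The Lagrange identity first makes `z` real; only then is there a Prüfer solution to compare the
eigenvector with. -/
theorem isEigenvalue_iff (h₁ : IntervalIntegrable q₁ volume 0 1)
    (h₂ : IntervalIntegrable q₂ volume 0 1) {θ : ℝ → ℝ → ℝ}
    (hθ : ∀ l, IsPruferAngle q₁ q₂ l (θ l)) (j : Fin 2) (z : ℂ) :
    IsEigenvalue (diracOp q₁ q₂ j) z ↔ ∃ l : ℝ, (l : ℂ) = z ∧ boundaryFun j (θ l 1) = 0 := by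
  constructor
  · rintro ⟨w, hw0, hw⟩
    obtain ⟨v, hv, hl, hr, hae⟩ := exists_isSolution_of_apply_eq w hw
    have hne : ∃ k, ∃ x ∈ Icc (0 : ℝ) 1, v k x ≠ 0 := by
      by_contra! hcon
      apply hw0
      ext k : 1
      apply Lp.ext
      filter_upwards [hae k, Lp.coeFn_zero ℂ 2 mu01, ae_restrict_mem measurableSet_Ioo]
        with x a1 a2 a3
      rw [a1, hcon k x (Ioo_subset_Icc_self a3)]
      exact a2.symm
    obtain ⟨k, x, hx, hne⟩ := hne
    have him := hv.im_eq_zero hl hr hx hne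
    have hz : ((z.re : ℝ) : ℂ) = z := Complex.ext rfl (by simp [him])
    refine ⟨z.re, hz, ?_⟩
    rw [← hz] at hw
    obtain ⟨c, hc, hc'⟩ := eigenspace_eq_span h₁ h₂ (hθ z.re) w hw
    rw [← pruferSolution_apply_one_eq_zero_iff (q₁ := q₁) (q₂ := q₂)]
    refine (mul_eq_zero.1 hc').resolve_left fun h0 => hw0 ?_
    rw [hc, h0, zero_smul]
  · rintro ⟨l, rfl, hb⟩
    have hs := (hθ l).isSolution h₁ h₂
    obtain ⟨w, hw, hA⟩ := hs.exists_eigenvector (j := j) (pruferSolution_one_zero (hθ l))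
      ((pruferSolution_apply_one_eq_zero_iff j).2 hb)
    exact ⟨w, by rw [hw]; exact toH_pruferSolution_ne_zero h₁ h₂ (hθ l), hA⟩

/-- Each eigenspace is spanned by one Prüfer solution, and injectivity of `ν` makes each value occur
once, so both multiplicities equal `1`. -/
theorem enumeratesEigenvalues (h₁ : IntervalIntegrable q₁ volume 0 1)
    (h₂ : IntervalIntegrable q₂ volume 0 1) {θ : ℝ → ℝ → ℝ}
    (hθ : ∀ l, IsPruferAngle q₁ q₂ l (θ l)) (j : Fin 2) {ν : ℤ → ℝ}
    (hinj : Function.Injective ν)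
    (hν : ∀ l, boundaryFun j (θ l 1) = 0 ↔ ∃ n, ν n = l) :
    EnumeratesEigenvalues (diracOp q₁ q₂ j) ν := by
  refine ⟨fun z => ?_, fun n => ?_⟩
  · rw [isEigenvalue_iff h₁ h₂ hθ]
    constructor
    · rintro ⟨l, rfl, hl⟩
      obtain ⟨n, hn⟩ := (hν l).1 hl
      exact ⟨n, by rw [hn]⟩
    · rintro ⟨n, hn⟩
      exact ⟨ν n, hn, (hν _).2 ⟨n, rfl⟩⟩
  · have hu : Cardinal.mk {m : ℤ // ν m = ν n} = 1 := by
      rw [Cardinal.eq_one_iff_unique]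
      exact ⟨⟨fun a b => Subtype.ext (hinj (a.2.trans b.2.symm))⟩, ⟨⟨n, rfl⟩⟩⟩
    rw [hu]
    have hmem : ∀ w : (diracOp q₁ q₂ j).domain, w ∈ eigenspace (diracOp q₁ q₂ j) (ν n) ↔
        diracOp q₁ q₂ j w = (ν n : ℂ) • (w : H) := by
      intro w
      rw [eigenspace, LinearMap.mem_ker, LinearMap.sub_apply, sub_eq_zero]
      rfl
    have hs := (hθ (ν n)).isSolution h₁ h₂
    have hne := toH_pruferSolution_ne_zero h₁ h₂ (hθ (ν n))
    obtain ⟨w, hw, hA⟩ := hs.exists_eigenvector (j := j) (pruferSolution_one_zero (hθ (ν n)))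
      ((pruferSolution_apply_one_eq_zero_iff j).2 ((hν _).2 ⟨n, rfl⟩))
    refine rank_eq_one (⟨w, (hmem w).2 hA⟩ : eigenspace (diracOp q₁ q₂ j) (ν n))
      (fun h0 => hne ?_) fun y => ?_
    · rw [← hw]
      have := congrArg (fun y : eigenspace (diracOp q₁ q₂ j) (ν n) =>
        ((y : (diracOp q₁ q₂ j).domain) : H)) h0
      simpa using this
    · obtain ⟨c, hc, -⟩ := eigenspace_eq_span h₁ h₂ (hθ (ν n)) y.1 ((hmem y.1).1 y.2)
      refine ⟨c, ?_⟩
      ext1; ext1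
      rw [hc]
      simp [hw]

end

/-! ### Conjugated reflections and exponential functionals on `L_p` -/

section

open scoped ComplexConjugate

section Pairing

variable {α : Type*} [MeasurableSpace α] {μ : Measure α} [IsProbabilityMeasure μ]
  {p : ENNReal} [Fact (1 ≤ p)]

theorem integrable_of_Lp (f : Lp ℂ p μ) : Integrable f μ :=
  (Lp.memLp f).integrable Fact.out

theorem integral_norm_le_norm_Lp (f : Lp ℂ p μ) : ∫ x, ‖f x‖ ∂μ ≤ ‖f‖ := by
  rw [Lp.norm_def, integral_norm_eq_lintegral_enorm (Lp.aestronglyMeasurable f),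
    ← eLpNorm_one_eq_lintegral_enorm]
  exact ENNReal.toReal_mono (Lp.eLpNorm_ne_top f)
    (eLpNorm_le_eLpNorm_of_exponent_le Fact.out (Lp.aestronglyMeasurable f))

/-- Integration against a function bounded by one, as a functional on `Lp`. -/
def pairing (p : ENNReal) [Fact (1 ≤ p)] (μ : Measure α) [IsProbabilityMeasure μ] (w : α → ℂ)
    (hw : AEStronglyMeasurable w μ) (hb : ∀ x, ‖w x‖ ≤ 1) : Lp ℂ p μ →L[ℂ] ℂ :=
  LinearMap.mkContinuous
    { toFun := fun f => ∫ x, w x * f x ∂μ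
      map_add' := fun f g => by
        rw [← integral_add ((integrable_of_Lp f).bdd_mul hw (Filter.Eventually.of_forall hb))
          ((integrable_of_Lp g).bdd_mul hw (Filter.Eventually.of_forall hb))]
        refine integral_congr_ae ?_
        filter_upwards [Lp.coeFn_add f g] with x hx
        rw [hx, Pi.add_apply, mul_add]
      map_smul' := fun c f => by
        rw [RingHom.id_apply, smul_eq_mul, ← integral_const_mul]
        refine integral_congr_ae ?_
        filter_upwards [Lp.coeFn_smul c f] with x hx
        rw [hx, Pi.smul_apply, smul_eq_mul]; ring } 1 fun f => by
    rw [one_mul]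
    refine le_trans ?_ (integral_norm_le_norm_Lp f)
    refine norm_integral_le_of_norm_le (integrable_of_Lp f).norm
      (Filter.Eventually.of_forall fun x => ?_)
    rw [norm_mul]
    exact mul_le_of_le_one_left (norm_nonneg _) (hb x)

theorem pairing_apply {w : α → ℂ} (hw : AEStronglyMeasurable w μ) (hb : ∀ x, ‖w x‖ ≤ 1)
    (f : Lp ℂ p μ) : pairing p μ w hw hb f = ∫ x, w x * f x ∂μ := rfl

theorem norm_pairing_le {w : α → ℂ} (hw : AEStronglyMeasurable w μ) (hb : ∀ x, ‖w x‖ ≤ 1)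
    (f : Lp ℂ p μ) : ‖pairing p μ w hw hb f‖ ≤ ‖f‖ := by
  have := (pairing p μ w hw hb).le_of_opNorm_le (LinearMap.mkContinuous_norm_le _ zero_le_one _) f
  rwa [one_mul] at this

end Pairing

instance : IsProbabilityMeasure mu01 := ⟨by simp⟩

variable {p : ENNReal} [Fact (1 ≤ p)]

/-- Complex conjugation on `Lp`. -/
def conjLp (p : ENNReal) [Fact (1 ≤ p)] :
    Lp ℂ p (volume : Measure ℝ) →L[ℝ] Lp ℂ p (volume : Measure ℝ) :=
  (Complex.conjCLE : ℂ →L[ℝ] ℂ).compLpL p volume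

theorem norm_conjLp_le (f : Lp ℂ p (volume : Measure ℝ)) : ‖conjLp p f‖ ≤ ‖f‖ := by
  have := (Complex.conjCLE : ℂ →L[ℝ] ℂ).norm_compLp_le f
  rwa [Complex.conjCLE_norm, one_mul] at this

/-- The conjugated reflection `(T_t f)(x) = conj (f (t - x))` on `Lp`. -/
def conjReflect (t : ℝ) (f : Lp ℂ p (volume : Measure ℝ)) : Lp ℂ p (volume : Measure ℝ) :=
  conjLp p (Lp.compMeasurePreserving (fun x => t - x)
    (Measure.measurePreserving_sub_left volume t) f)

theorem conjReflect_ae (t : ℝ) (f : Lp ℂ p (volume : Measure ℝ)) :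
    conjReflect t f =ᵐ[volume] fun x => conj (f (t - x)) := by
  filter_upwards [(Complex.conjCLE : ℂ →L[ℝ] ℂ).coeFn_compLp
    (Lp.compMeasurePreserving (fun x => t - x)
    (Measure.measurePreserving_sub_left volume t) f), Lp.coeFn_compMeasurePreserving f
    (Measure.measurePreserving_sub_left volume t)] with x h1 h2
  refine Eq.trans h1 ?_
  rw [h2]
  rfl

theorem norm_conjReflect_sub_le (t : ℝ) (f g : Lp ℂ p (volume : Measure ℝ)) :
    ‖conjReflect t f - conjReflect t g‖ ≤ ‖f - g‖ := by
  rw [conjReflect, conjReflect, ← map_sub, ← map_sub]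
  exact (norm_conjLp_le _).trans (Lp.norm_compMeasurePreserving _ _).le

theorem continuous_conjReflect (hp : p ≠ ⊤) {f : ℝ → Lp ℂ p (volume : Measure ℝ)}
    (hf : Continuous f) : Continuous fun t => conjReflect t (f t) := by
  have hg : Continuous fun t : ℝ => (⟨fun x => t - x, by fun_prop⟩ : C(ℝ, ℝ)) :=
    ContinuousMap.continuous_of_continuous_uncurry _ (by
      simp only [Function.uncurry_def, ContinuousMap.coe_mk]; fun_prop)
  have := hf.compMeasurePreservingLp hg
    (fun t => Measure.measurePreserving_sub_left volume t) hp
  exact (conjLp p).continuous.comp this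

/-- The closed subspace of functions supported in `[0,t]`. -/
def supportedIn (p : ENNReal) [Fact (1 ≤ p)] (t : ℝ) : Set (Lp ℂ p (volume : Measure ℝ)) :=
  {f | LpToLpRestrictCLM ℝ ℂ ℂ volume p (Icc 0 t)ᶜ f = 0}

theorem isClosed_supportedIn (t : ℝ) : IsClosed (supportedIn p t) :=
  isClosed_singleton.preimage (LpToLpRestrictCLM ℝ ℂ ℂ volume p (Icc 0 t)ᶜ).continuous

theorem mem_supportedIn_iff {t : ℝ} {f : Lp ℂ p (volume : Measure ℝ)} :
    f ∈ supportedIn p t ↔ ∀ᵐ x, x ∉ Icc 0 t → f x = 0 := by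
  have hr := ae_restrict_iff' (μ := (volume : Measure ℝ)) (p := fun x => f x = 0)
    (measurableSet_Icc (a := (0 : ℝ)) (b := t)).compl
  simp only [mem_compl_iff] at hr
  rw [← hr]
  have h := LpToLpRestrictCLM_coeFn (μ := (volume : Measure ℝ)) ℂ (Icc 0 t)ᶜ f
  constructor
  · intro h0
    change LpToLpRestrictCLM ℝ ℂ ℂ volume p (Icc 0 t)ᶜ f = 0 at h0
    rw [h0] at h
    filter_upwards [h, Lp.coeFn_zero ℂ p (volume.restrict (Icc 0 t)ᶜ)] with x h1 h2
    rw [← h1, h2]; rfl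
  · intro h0
    apply Lp.ext
    filter_upwards [h, Lp.coeFn_zero ℂ p (volume.restrict (Icc 0 t)ᶜ), h0] with x h1 h2 h3
    rw [h1, h2, h3]; rfl

theorem supportedIn_mono {s t : ℝ} (h : s ≤ t) : supportedIn p s ⊆ supportedIn p t := by
  intro f hf
  rw [mem_supportedIn_iff] at hf ⊢
  filter_upwards [hf] with x hx hx'
  exact hx fun h' => hx' ⟨h'.1, h'.2.trans h⟩

theorem conjReflect_mem_supportedIn {t : ℝ} {f : Lp ℂ p (volume : Measure ℝ)}
    (hf : f ∈ supportedIn p t) : conjReflect t f ∈ supportedIn p t := by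
  rw [mem_supportedIn_iff] at hf ⊢
  have h2 := (Measure.measurePreserving_sub_left (volume : Measure ℝ) t).quasiMeasurePreserving.ae
    hf
  filter_upwards [conjReflect_ae t f, h2] with x h1 h2 hx
  rw [h1, h2 fun h => hx ⟨by linarith [h.2], by linarith [h.1]⟩, map_zero]

/-- The Fourier-type functional `f ↦ ∫₀¹ exp(-2iλx) f(x) dx`. -/
def expFunctional (p : ENNReal) [Fact (1 ≤ p)] (l : ℝ) :
    Lp ℂ p (volume : Measure ℝ) →L[ℂ] ℂ :=
  (pairing p mu01 (fun x => Complex.exp (-(2 * l * x : ℝ) * Complex.I))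
    (by fun_prop) (fun x => by
      rw [← Complex.ofReal_neg, Complex.norm_exp_ofReal_mul_I])).comp
    (LpToLpRestrictCLM ℝ ℂ ℂ volume p (Ioo 0 1))

theorem expFunctional_apply (l : ℝ) (f : Lp ℂ p (volume : Measure ℝ)) :
    expFunctional p l f = ∫ x in Ioo (0 : ℝ) 1, Complex.exp (-(2 * l * x : ℝ) * Complex.I) * f x := by
  rw [expFunctional, ContinuousLinearMap.comp_apply, pairing_apply]
  refine integral_congr_ae ?_
  filter_upwards [LpToLpRestrictCLM_coeFn ℂ (Ioo 0 1) f] with x hx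
  rw [hx]

theorem norm_expFunctional_le (l : ℝ) (f : Lp ℂ p (volume : Measure ℝ)) :
    ‖expFunctional p l f‖ ≤ ‖f‖ := by
  have h1 : ‖expFunctional p l f‖ ≤ ‖LpToLpRestrictCLM ℝ ℂ ℂ volume p (Ioo 0 1) f‖ := by
    rw [expFunctional, ContinuousLinearMap.comp_apply]
    apply norm_pairing_le
  refine h1.trans ?_
  rw [Lp.norm_def, Lp.norm_def]
  refine ENNReal.toReal_mono (Lp.eLpNorm_ne_top f) ?_
  rw [eLpNorm_congr_ae (LpToLpRestrictCLM_coeFn ℂ (Ioo 0 1) f)]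
  exact eLpNorm_restrict_le _ _ _ _

/-- Substitute `x ↦ t - x`. The support condition lets the integral over `(0,1)` be taken over the
whole line, where this substitution is free. Thus the factor `exp(-2ilt) conj` in the amplitude
equation is realised by an operator on kernels independent of `l`. -/
theorem expFunctional_conjReflect (l : ℝ) {t : ℝ} (ht : t ∈ Icc (0 : ℝ) 1)
    {f : Lp ℂ p (volume : Measure ℝ)} (hf : f ∈ supportedIn p t) :
    expFunctional p l (conjReflect t f) =
      Complex.exp (-(2 * l * t : ℝ) * Complex.I) * conj (expFunctional p l f) := by
  have full : ∀ g ∈ supportedIn p t, expFunctional p l g =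
      ∫ x, Complex.exp (-(2 * l * x : ℝ) * Complex.I) * g x := by
    intro g hg
    rw [expFunctional_apply, ← integral_Icc_eq_integral_Ioo]
    refine setIntegral_eq_integral_of_ae_compl_eq_zero ?_
    filter_upwards [mem_supportedIn_iff.1 hg] with x hx hx'
    rw [hx fun h => hx' ⟨h.1, h.2.trans ht.2⟩, mul_zero]
  rw [full _ (conjReflect_mem_supportedIn hf), full _ hf, ← integral_conj, ← integral_const_mul]
  rw [← integral_sub_left_eq_self (fun x => Complex.exp (-(2 * l * t : ℝ) * Complex.I) *
    conj (Complex.exp (-(2 * l * x : ℝ) * Complex.I) * f x)) volume t]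
  refine integral_congr_ae ?_
  filter_upwards [conjReflect_ae t f] with x hx
  rw [hx, map_mul, ← Complex.exp_conj, ← mul_assoc, ← Complex.exp_add]
  congr 2
  simp only [map_mul, map_neg, Complex.conj_ofReal, Complex.conj_I]
  push_cast; ring

/-- Two truncations differ by `q` restricted to the interval between `s` and `t`; for finite `p` its
norm is small when the interval is short. -/
theorem continuous_toLp_indicator_Iic (hp : p ≠ ⊤) {q : ℝ → ℂ}
    (hq : MemLp q p (volume : Measure ℝ)) :
    Continuous fun t : ℝ => (hq.indicator (measurableSet_Iic (a := t))).toLp := by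
  rw [Metric.continuous_iff]
  intro t ε hε
  obtain ⟨δ, hδ, h⟩ := hq.eLpNorm_indicator_le Fact.out hp (half_pos hε)
  refine ⟨δ, hδ, fun s hs => ?_⟩
  refine lt_of_le_of_lt ?_ (half_lt_self hε)
  rw [dist_eq_norm, ← MemLp.toLp_sub, Lp.norm_toLp]
  refine ENNReal.toReal_le_of_le_ofReal (half_pos hε).le ?_
  rw [← eLpNorm_norm]
  have e : (fun x => ‖((Iic s).indicator q - (Iic t).indicator q) x‖) =
      fun x => ‖(uIoc s t).indicator q x‖ := by
    ext x
    simp only [Pi.sub_apply, indicator_apply, mem_Iic, uIoc, mem_Ioc, inf_lt_iff, le_sup_iff]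
    by_cases h1 : x ≤ s <;> by_cases h2 : x ≤ t <;> simp [h1, h2, not_lt.2, not_le.1]
  rw [e, eLpNorm_norm]
  refine h _ measurableSet_uIoc ?_
  rw [Real.volume_uIoc]
  refine ENNReal.ofReal_le_ofReal ?_
  rw [abs_sub_comm]; exact hs.le

end

/-! ### An `l`-independent kernel for the amplitude -/

section

open scoped ComplexConjugate

variable {p : ENNReal} [Fact (1 ≤ p)]

theorem MemLp.intervalIntegrable_mu01 {E : Type*} [NormedAddCommGroup E] {q : ℝ → E}
    (hq : MemLp q p mu01) : IntervalIntegrable q volume 0 1 := by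
  rw [intervalIntegrable_iff_integrableOn_Ioo_of_le zero_le_one]
  exact hq.integrable Fact.out

/-- Solve `h(t) = 1_{[0,t]}(-iq) + ∫₀ᵗ -iq(s) T_s h(s) ds` in `L_p`, where `T_s` is the conjugated
reflection. Applying the exponential functional turns `T_s` into `exp(-2ils) conj`, for every real
`l` simultaneously. -/
theorem exists_transformation_kernel (hp : p ≠ ⊤) {q : ℝ → ℂ} (hq : MemLp q p mu01) :
    ∃ h : ℝ → Lp ℂ p (volume : Measure ℝ), Continuous h ∧
      ∀ l : ℝ, ∀ t ∈ Icc (0 : ℝ) 1, 1 + expFunctional p l (h t) = 1 + ∫ s in (0 : ℝ)..t,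
        -Complex.I * q s * (Complex.exp (-(2 * l * s : ℝ) * Complex.I) *
          conj (1 + expFunctional p l (h s))) := by
  have hqi : IntervalIntegrable q volume 0 1 := MemLp.intervalIntegrable_mu01 hq
  set q' : ℝ → ℂ := (Ioo 0 1).indicator fun x => -Complex.I * q x with hq'
  have hq'm : MemLp q' p volume :=
    (memLp_indicator_iff_restrict measurableSet_Ioo).2 (hq.const_mul _)
  let F : ℝ → Lp ℂ p (volume : Measure ℝ) → Lp ℂ p (volume : Measure ℝ) :=
    fun t y => (-Complex.I * q t) • conjReflect t y
  have hFi : ∀ v : ℝ → Lp ℂ p (volume : Measure ℝ), Continuous v →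
      IntervalIntegrable (fun s => F s (v s)) volume 0 1 := fun v hv =>
    (hqi.const_mul (-Complex.I)).smul_continuousOn (continuous_conjReflect hp hv).continuousOn
  let x₀ : ℝ → Lp ℂ p (volume : Measure ℝ) := fun t =>
    (hq'm.indicator (measurableSet_Iic (a := t))).toLp
  have hx₀ : Continuous x₀ := continuous_toLp_indicator_Iic hp hq'm
  have hx₀ae : ∀ t, x₀ t =ᵐ[volume] (Iic t).indicator q' := fun t => MemLp.coeFn_toLp _
  obtain ⟨h, hc, hC, he⟩ := volterra_exists (F := F) (k := fun t => ‖q t‖) hqi.norm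
    (fun t _ => norm_nonneg _) (fun t _ x y => by
      rw [← smul_sub, norm_smul, norm_mul, norm_neg, Complex.norm_I, one_mul]
      exact mul_le_mul_of_nonneg_left (norm_conjReflect_sub_le t x y) (norm_nonneg _))
    hFi hx₀.continuousOn (C := supportedIn p) isClosed_supportedIn (fun v hv hvC t ht => by
      change LpToLpRestrictCLM ℝ ℂ ℂ volume p (Icc 0 t)ᶜ _ = 0
      have hsub : uIcc 0 t ⊆ uIcc (0 : ℝ) 1 :=
        uIcc_subset_uIcc left_mem_uIcc (by rwa [uIcc_of_le zero_le_one])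
      rw [map_add, ← ContinuousLinearMap.intervalIntegral_comp_comm _
        ((hFi v hv).mono_set hsub)]
      have e1 : x₀ t ∈ supportedIn p t := by
        rw [mem_supportedIn_iff]
        filter_upwards [hx₀ae t] with x hx hx'
        rw [hx, hq', indicator_indicator, indicator_of_notMem]
        rintro ⟨h1, h2⟩
        exact hx' ⟨h2.1.le, h1⟩
      have e1' : LpToLpRestrictCLM ℝ ℂ ℂ volume p (Icc 0 t)ᶜ (x₀ t) = 0 := e1
      rw [e1', zero_add]
      -- For `s ≤ t` the reflection about `s/2` preserves support in `[0,s]`, which is contained in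
      -- `[0,t]`.
      refine intervalIntegral.integral_zero_ae (Filter.Eventually.of_forall fun s hs => ?_)
      rw [uIoc_of_le ht.1] at hs
      have h3 : conjReflect s (v s) ∈ supportedIn p t := supportedIn_mono hs.2
        (conjReflect_mem_supportedIn (hvC s ⟨hs.1.le, hs.2.trans ht.2⟩))
      have h3' : LpToLpRestrictCLM ℝ ℂ ℂ volume p (Icc 0 t)ᶜ (conjReflect s (v s)) = 0 := h3
      rw [map_smul, h3', smul_zero])
    (v₀ := fun _ => 0) continuous_const (fun s _ => map_zero _)
  refine ⟨h, hc, fun l t ht => ?_⟩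
  congr 1
  have hsub : uIcc 0 t ⊆ uIcc (0 : ℝ) 1 :=
    uIcc_subset_uIcc left_mem_uIcc (by rwa [uIcc_of_le zero_le_one])
  have hi0 : IntervalIntegrable (fun s => -Complex.I * q s *
      Complex.exp (-(2 * l * s : ℝ) * Complex.I)) volume 0 1 :=
    (hqi.const_mul _).mul_continuousOn (by fun_prop)
  have hLc : Continuous fun s => conj (expFunctional p l (h s)) :=
    Complex.continuous_conj.comp ((expFunctional p l).continuous.comp hc)
  have e0 : expFunctional p l (x₀ t) = ∫ s in (0 : ℝ)..t, -Complex.I * q s *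
      Complex.exp (-(2 * l * s : ℝ) * Complex.I) := by
    rw [expFunctional_apply, intervalIntegral.integral_of_le ht.1, ← integral_Ioc_eq_integral_Ioo,
      ← integral_indicator measurableSet_Ioc, ← integral_indicator measurableSet_Ioc]
    refine integral_congr_ae ?_
    have h1 : ∀ᵐ x : ℝ, x ≠ 1 := by simp [ae_iff, measure_singleton]
    filter_upwards [hx₀ae t, h1] with x hx hx1
    simp only [indicator_apply, hx, mem_Ioc, mem_Iic, hq', mem_Ioo]
    by_cases a : 0 < x
    · by_cases b : x ≤ t
      · have c : x ≤ 1 := b.trans ht.2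
        simp only [a, b, c, lt_of_le_of_ne c hx1, and_self, if_true]; ring
      · simp [b]
    · simp [a]
  rw [he t ht, map_add, ← ContinuousLinearMap.intervalIntegral_comp_comm _
    ((hFi h hc).mono_set hsub), e0, ← intervalIntegral.integral_add (hi0.mono_set hsub)]
  · refine intervalIntegral.integral_congr fun s hs => ?_
    rw [uIcc_of_le ht.1] at hs
    have hs' : s ∈ Icc (0 : ℝ) 1 := ⟨hs.1, hs.2.trans ht.2⟩
    simp only [F]
    rw [map_smul, expFunctional_conjReflect l hs' (hC s hs'), smul_eq_mul, map_add, map_one]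
    ring
  · have := (hFi h hc).mono_set hsub
    exact ⟨(expFunctional p l).integrable_comp this.1, (expFunctional p l).integrable_comp this.2⟩

variable {q₁ q₂ : ℝ → ℝ}

/-- The complex amplitude of the Prüfer solution with the free phase removed. -/
def amplitude (q₁ q₂ : ℝ → ℝ) (l : ℝ) (θ : ℝ → ℝ) (x : ℝ) : ℂ :=
  Complex.exp (logRadius q₁ q₂ θ x + (θ x - l * x) * Complex.I)

theorem IsPruferAngle.amplitude_eq (h₁ : IntervalIntegrable q₁ volume 0 1)
    (h₂ : IntervalIntegrable q₂ volume 0 1) {l : ℝ} {θ : ℝ → ℝ} (h : IsPruferAngle q₁ q₂ l θ) :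
    ContinuousOn (amplitude q₁ q₂ l θ) (Icc 0 1) ∧
    IntervalIntegrable (fun s => -Complex.I * (q₁ s + q₂ s * Complex.I) *
      (Complex.exp (-(2 * l * s : ℝ) * Complex.I) * conj (amplitude q₁ q₂ l θ s))) volume 0 1 ∧
    ∀ t ∈ Icc (0 : ℝ) 1, amplitude q₁ q₂ l θ t = 1 + ∫ s in (0 : ℝ)..t,
      -Complex.I * (q₁ s + q₂ s * Complex.I) *
      (Complex.exp (-(2 * l * s : ℝ) * Complex.I) * conj (amplitude q₁ q₂ l θ s)) := by
  have hR := ((intervalIntegrable_logRadius h₁ h₂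
    h.cont).absolutelyContinuousOnInterval_intervalIntegral left_mem_uIcc).comp_contDiff
    (φ := fun y : ℝ => (y : ℂ)) Complex.ofRealCLM.contDiff
  have hid : AbsolutelyContinuousOnInterval (fun x : ℝ => l * x) 0 1 :=
    ContDiffOn.absolutelyContinuousOnInterval (by fun_prop)
  have hφ := ((h.ac h₁ h₂).sub hid).comp_contDiff (φ := fun y : ℝ => (y : ℂ) * Complex.I)
    (Complex.ofRealCLM.contDiff.mul contDiff_const)
  have hac : AbsolutelyContinuousOnInterval (amplitude q₁ q₂ l θ) 0 1 := by
    have := (hR.add hφ).comp_contDiff (φ := Complex.exp) Complex.contDiff_exp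
    convert! this using 2 with x
    simp only [amplitude, Pi.add_apply, Pi.sub_apply]
    push_cast
    rfl
  have hder : ∀ᵐ x ∂mu01, HasDerivAt (amplitude q₁ q₂ l θ)
      (-Complex.I * (q₁ x + q₂ x * Complex.I) *
      (Complex.exp (-(2 * l * x : ℝ) * Complex.I) * conj (amplitude q₁ q₂ l θ x))) x := by
    filter_upwards [h.ae_hasDerivAt h₁ h₂, ae_hasDerivAt_logRadius h₁ h₂ h.cont] with x a b
    have hx : HasDerivAt (fun x : ℝ => ((l * x : ℝ) : ℂ)) (l : ℂ) x := by
      have := ((hasDerivAt_id x).const_mul l).ofReal_comp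
      simpa using this
    have := (b.ofReal_comp.add ((a.ofReal_comp.sub hx).mul_const Complex.I)).cexp
    have e : amplitude q₁ q₂ l θ = fun x => Complex.exp ((logRadius q₁ q₂ θ x : ℂ) +
        ((θ x : ℂ) - ((l * x : ℝ) : ℂ)) * Complex.I) := by
      ext x; simp [amplitude]
    rw [e]
    convert! this using 1
    simp only [Pi.add_apply, Pi.sub_apply]
    set E := (logRadius q₁ q₂ θ x : ℂ) + ((θ x : ℂ) - ((l * x : ℝ) : ℂ)) * Complex.I with hE
    -- Conjugation reverses the phase `θ - lx`; with `exp(-2ilx)` the free phase cancels and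
    -- `exp(-2iθ)` remains, which matches the Prüfer equations.
    have hconj : Complex.exp (-(2 * l * x : ℝ) * Complex.I) * conj (Complex.exp E) =
        Complex.exp E * Complex.exp (-(2 * θ x : ℝ) * Complex.I) := by
      rw [← Complex.exp_conj, ← Complex.exp_add, ← Complex.exp_add]
      congr 1
      simp only [hE, map_add, map_mul, map_sub, Complex.conj_ofReal, Complex.conj_I]
      push_cast; ring
    have hcs : Complex.exp (-(2 * θ x : ℝ) * Complex.I) =
        (Real.cos (2 * θ x) : ℂ) - (Real.sin (2 * θ x) : ℂ) * Complex.I := by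
      rw [← Complex.ofReal_neg, Complex.exp_mul_I, ← Complex.ofReal_cos, ← Complex.ofReal_sin,
        Real.cos_neg, Real.sin_neg]
      push_cast; ring
    rw [hconj, hcs]
    push_cast
    linear_combination (-Complex.exp E * (q₁ x * Complex.sin (2 * θ x) * (-1) +
      q₂ x * Complex.cos (2 * θ x) - q₂ x * Complex.sin (2 * θ x) * Complex.I)) * Complex.I_sq
  obtain ⟨hi, he⟩ := hac.ftc_complex zero_le_one hder
  refine ⟨by simpa [uIcc_of_le zero_le_one] using hac.continuousOn, hi, fun t ht => ?_⟩
  rw [he t ht]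
  congr 1
  simp [amplitude, logRadius, h.initial]

/-- Both sides solve one scalar Volterra equation. It is only real-linear because of the conjugate,
but it is Lipschitz with constant `|q|`, so uniqueness applies. -/
theorem amplitude_eq_one_add_expFunctional (h₁ : IntervalIntegrable q₁ volume 0 1)
    (h₂ : IntervalIntegrable q₂ volume 0 1) {l : ℝ} {θ : ℝ → ℝ} (h : IsPruferAngle q₁ q₂ l θ)
    {k : ℝ → Lp ℂ p (volume : Measure ℝ)} (hk : Continuous k)
    (hke : ∀ t ∈ Icc (0 : ℝ) 1, 1 + expFunctional p l (k t) = 1 + ∫ s in (0 : ℝ)..t,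
        -Complex.I * (q₁ s + q₂ s * Complex.I) * (Complex.exp (-(2 * l * s : ℝ) * Complex.I) *
          conj (1 + expFunctional p l (k s)))) :
    ∀ t ∈ Icc (0 : ℝ) 1, amplitude q₁ q₂ l θ t = 1 + expFunctional p l (k t) := by
  obtain ⟨hc, hi, he⟩ := h.amplitude_eq h₁ h₂
  have hq : IntervalIntegrable (fun s => -Complex.I * ((q₁ s : ℂ) + q₂ s * Complex.I))
      volume 0 1 :=
    (h₁.complex_ofReal.add (h₂.complex_ofReal.mul_const _)).const_mul _
  have hkc : Continuous fun t => 1 + expFunctional p l (k t) :=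
    continuous_const.add ((expFunctional p l).continuous.comp hk)
  refine volterra_unique (x₀ := fun _ => (1 : ℂ)) (k := fun s => ‖-Complex.I *
    ((q₁ s : ℂ) + q₂ s * Complex.I)‖) (F := fun s y => -Complex.I * (q₁ s + q₂ s * Complex.I) *
    (Complex.exp (-(2 * l * s : ℝ) * Complex.I) * conj y)) hq.norm (fun _ _ => norm_nonneg _)
    (fun t _ x y => ?_) hi ?_ hc hkc.continuousOn he hke
  · rw [← mul_sub, ← mul_sub, ← map_sub, norm_mul, norm_mul (Complex.exp _), ← Complex.ofReal_neg,
      Complex.norm_exp_ofReal_mul_I, one_mul, RCLike.norm_conj]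
  · exact hq.mul_continuousOn (Continuous.continuousOn
      (Continuous.mul (by fun_prop) (Complex.continuous_conj.comp hkc)))

end

/-! ### First order asymptotics of the angle -/

section

open scoped ComplexConjugate

variable {p : ENNReal} [Fact (1 ≤ p)] {q₁ q₂ : ℝ → ℝ}

theorem tendsto_expFunctional_cocompact (f : Lp ℂ p (volume : Measure ℝ)) :
    Filter.Tendsto (fun l => expFunctional p l f) (Filter.cocompact ℝ) (nhds 0) := by
  have h := Real.tendsto_integral_exp_smul_cocompact ((Ioo (0 : ℝ) 1).indicator f)
  have hπ : Filter.Tendsto (fun l : ℝ => l / Real.pi) (Filter.cocompact ℝ)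
      (Filter.cocompact ℝ) := by
    simp_rw [div_eq_mul_inv]
    exact (Homeomorph.mulRight₀ _
      (inv_ne_zero Real.pi_ne_zero)).isClosedEmbedding.tendsto_cocompact
  refine (h.comp hπ).congr fun l => ?_
  rw [Function.comp_apply, expFunctional_apply, ← integral_indicator measurableSet_Ioo]
  refine integral_congr_ae (Filter.Eventually.of_forall fun x => ?_)
  simp only [indicator_apply]
  split_ifs
  · rw [Circle.smul_def, Real.fourierChar_apply, smul_eq_mul]
    congr 2
    push_cast
    have : (Real.pi : ℂ) ≠ 0 := by exact_mod_cast Real.pi_ne_zero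
    field_simp
  · rw [smul_zero]

/-- Riemann–Lebesgue is uniform on the compact path `k([0,1])`, because the functionals have norm at
most one for all `l`. -/
theorem eventually_norm_expFunctional_lt {k : ℝ → Lp ℂ p (volume : Measure ℝ)}
    (hk : Continuous k) {ε : ℝ} (hε : 0 < ε) :
    ∀ᶠ l in Filter.cocompact ℝ, ∀ t ∈ Icc (0 : ℝ) 1, ‖expFunctional p l (k t)‖ < ε := by
  refine isCompact_Icc.induction_on (p := fun s => ∀ᶠ l in Filter.cocompact ℝ, ∀ t ∈ s,
    ‖expFunctional p l (k t)‖ < ε) (by simp) ?_ ?_ ?_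
  · intro s t hst h
    filter_upwards [h] with l hl x hx using hl x (hst hx)
  · intro s t hs ht
    filter_upwards [hs, ht] with l h1 h2 x hx
    exact hx.elim (h1 x) (h2 x)
  · intro t _
    refine ⟨k ⁻¹' Metric.ball (k t) (ε / 2), mem_nhdsWithin_of_mem_nhds
      (hk.continuousAt.preimage_mem_nhds (Metric.ball_mem_nhds _ (half_pos hε))), ?_⟩
    have := (tendsto_expFunctional_cocompact (k t)).norm
    rw [norm_zero] at this
    filter_upwards [this.eventually_lt_const (half_pos hε)] with l hl x hx
    have h1 : ‖expFunctional p l (k x - k t)‖ < ε / 2 :=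
      (norm_expFunctional_le l _).trans_lt (by simpa [dist_eq_norm] using hx)
    calc ‖expFunctional p l (k x)‖ = ‖expFunctional p l (k x - k t) + expFunctional p l (k t)‖ := by
          rw [map_sub, sub_add_cancel]
      _ ≤ _ := norm_add_le _ _
      _ < ε := by linarith

theorem abs_lt_pi_div_two_of_cos_pos {φ : ℝ → ℝ} (hφ : ContinuousOn φ (Icc 0 1)) (h0 : φ 0 = 0)
    (hcos : ∀ t ∈ Icc (0 : ℝ) 1, 0 < Real.cos (φ t)) : |φ 1| < Real.pi / 2 := by
  rw [abs_lt]
  constructor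
  · by_contra! h
    obtain ⟨y, hy, he⟩ := intermediate_value_Icc' zero_le_one hφ
      (show -(Real.pi / 2) ∈ Icc (φ 1) (φ 0) from ⟨h, by rw [h0]; linarith [Real.pi_pos]⟩)
    have := hcos y hy
    rw [he, Real.cos_neg, Real.cos_pi_div_two] at this
    exact lt_irrefl _ this
  · by_contra! h
    obtain ⟨y, hy, he⟩ := intermediate_value_Icc zero_le_one hφ
      (show Real.pi / 2 ∈ Icc (φ 0) (φ 1) from ⟨by rw [h0]; linarith [Real.pi_pos], h⟩)
    have := hcos y hy
    rw [he, Real.cos_pi_div_two] at this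
    exact lt_irrefl _ this

theorem amplitude_re (l : ℝ) (θ : ℝ → ℝ) (x : ℝ) : (amplitude q₁ q₂ l θ x).re =
    Real.exp (logRadius q₁ q₂ θ x) * Real.cos (θ x - l * x) := by
  rw [amplitude, Complex.exp_re]; simp

theorem amplitude_im (l : ℝ) (θ : ℝ → ℝ) (x : ℝ) : (amplitude q₁ q₂ l θ x).im =
    Real.exp (logRadius q₁ q₂ θ x) * Real.sin (θ x - l * x) := by
  rw [amplitude, Complex.exp_im]; simp

theorem norm_amplitude (l : ℝ) (θ : ℝ → ℝ) (x : ℝ) : ‖amplitude q₁ q₂ l θ x‖ =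
    Real.exp (logRadius q₁ q₂ θ x) := by
  rw [amplitude, Complex.norm_exp]; simp

/-- An amplitude close to `1` determines its phase only modulo `2π`. Uniformity in `t` keeps `cos(θ
- lt)` positive along `[0,1]`, so by continuity from `0` the phase stays in `(-π/2, π/2)`. -/
theorem tendsto_pruferAngle_sub {θ : ℝ → ℝ → ℝ}
    (hθ : ∀ l, IsPruferAngle q₁ q₂ l (θ l)) {k : ℝ → Lp ℂ p (volume : Measure ℝ)}
    (hk : Continuous k) (hA : ∀ l, ∀ t ∈ Icc (0 : ℝ) 1,
      amplitude q₁ q₂ l (θ l) t = 1 + expFunctional p l (k t)) :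
    Filter.Tendsto (fun l => θ l 1 - l) (Filter.cocompact ℝ) (nhds 0) := by
  rw [Metric.tendsto_nhds]
  intro ε hε
  -- The bound `1/2` keeps the radius above `1/2`, so `|sin| < ε/2` follows from `ε/4`; then `|sin
  -- x| ≥ (2/π)|x| ≥ |x|/2` gives `ε`.
  have hδ : 0 < min (1 / 2) (ε / 4) := by positivity
  filter_upwards [eventually_norm_expFunctional_lt hk hδ] with l hl
  have hb : ∀ t ∈ Icc (0 : ℝ) 1, ‖amplitude q₁ q₂ l (θ l) t - 1‖ < min (1 / 2) (ε / 4) := by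
    intro t ht
    rw [hA l t ht, add_sub_cancel_left]; exact hl t ht
  have hcos : ∀ t ∈ Icc (0 : ℝ) 1, 0 < Real.cos (θ l t - l * t) := by
    intro t ht
    have h1 := (Complex.abs_re_le_norm _).trans_lt ((hb t ht).trans_le (min_le_left _ _))
    rw [Complex.sub_re, Complex.one_re, amplitude_re, abs_lt] at h1
    exact pos_of_mul_pos_right (by linarith [h1.1]) (Real.exp_pos _).le
  have h1 : (1 : ℝ) ∈ Icc (0 : ℝ) 1 := right_mem_Icc.2 zero_le_one
  have hlt := abs_lt_pi_div_two_of_cos_pos (φ := fun t => θ l t - l * t)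
    (by have := (hθ l).cont; fun_prop) (by simp [(hθ l).initial]) hcos
  simp only [mul_one] at hlt
  have hsin := Real.mul_abs_le_abs_sin hlt.le
  have hn : 1 / 2 < Real.exp (logRadius q₁ q₂ (θ l) 1) := by
    rw [← norm_amplitude (q₁ := q₁) (q₂ := q₂) l]
    have := (hb 1 h1).trans_le (min_le_left _ _)
    have h2 := norm_sub_norm_le (1 : ℂ) (1 - amplitude q₁ q₂ l (θ l) 1)
    rw [sub_sub_cancel, norm_one, norm_sub_rev 1] at h2
    linarith
  have him := (Complex.abs_im_le_norm _).trans_lt ((hb 1 h1).trans_le (min_le_right _ _))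
  rw [Complex.sub_im, Complex.one_im, sub_zero, amplitude_im, abs_mul, mul_one,
    abs_of_pos (Real.exp_pos _)] at him
  rw [dist_zero_right, Real.norm_eq_abs]
  have hs : |Real.sin (θ l 1 - l)| < ε / 2 := by
    nlinarith [abs_nonneg (Real.sin (θ l 1 - l))]
  have hπ : (1 : ℝ) / 2 ≤ 2 / Real.pi := by
    rw [div_le_div_iff₀ two_pos Real.pi_pos]; linarith [Real.pi_le_four]
  nlinarith [abs_nonneg (θ l 1 - l)]

theorem tendsto_sub_of_pruferAngle_eq {θ : ℝ → ℝ → ℝ} {C : ℝ} (hC : ∀ l, |θ l 1 - l| ≤ C)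
    (hθ : Filter.Tendsto (fun l => θ l 1 - l) (Filter.cocompact ℝ) (nhds 0)) {ν : ℤ → ℝ} {c : ℝ}
    (hν : ∀ n, θ (ν n) 1 = Real.pi * (n + c)) :
    Filter.Tendsto (fun n => ν n - Real.pi * (n + c)) Filter.cofinite (nhds 0) := by
  have hν' : Filter.Tendsto ν Filter.cofinite (Filter.cocompact ℝ) := by
    have h0 : Filter.Tendsto (fun n : ℤ => ‖(n : ℝ)‖) Filter.cofinite Filter.atTop :=
      tendsto_norm_cocompact_atTop.comp Int.tendsto_coe_cofinite
    rw [← Metric.cobounded_eq_cocompact, ← tendsto_norm_atTop_iff_cobounded]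
    refine Filter.tendsto_atTop_mono (f := fun n : ℤ => ‖(n : ℝ)‖ + (-(4 * |c| + C))) (fun n => ?_)
      (Filter.tendsto_atTop_add_const_right _ _ h0)
    have h1 := hC (ν n)
    rw [hν] at h1
    have h2 : |Real.pi * n| ≤ |Real.pi * (n + c) - ν n| + |ν n| + |Real.pi * c| := by
      have e : Real.pi * n = (Real.pi * (n + c) - ν n) + ν n - Real.pi * c := by ring
      calc |Real.pi * n| = |(Real.pi * (n + c) - ν n) + ν n - Real.pi * c| := by rw [← e]
        _ ≤ |(Real.pi * (n + c) - ν n) + ν n| + |Real.pi * c| := abs_sub _ _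
        _ ≤ _ := by gcongr; exact abs_add_le _ _
    rw [abs_mul, abs_mul, abs_of_pos Real.pi_pos] at h2
    simp only [Real.norm_eq_abs]
    nlinarith [Real.pi_gt_three, Real.pi_le_four, abs_nonneg c, abs_nonneg (n : ℝ)]
  have := (hθ.comp hν').neg
  rw [neg_zero] at this
  refine this.congr fun n => ?_
  simp only [Function.comp_apply, hν]; ring

end

/-! ### Small solutions of `sin y + ∑ yᵏ bₖ = 0` for a bounded product without unit -/

section

section ZeroMap

variable {Y : Type*} [NormedAddCommGroup Y] [NormedSpace ℂ Y]

/-- For a bounded bilinear product `C` the map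
`y ↦ -∑ yᵏ bₖ + (y - sin y)`, whose fixed points solve `sin y + ∑ yᵏ bₖ = 0`. -/
def zeroMap (C : Y →L[ℂ] Y →L[ℂ] Y) (b : ℕ → Y) (y : Y) : Y :=
  -∑' k, (C y ^ k) (b k) +
    ∑' k : ℕ, ((-1) ^ k / (2 * k + 3).factorial : ℂ) • (C y ^ (2 * k + 2)) y

variable {C : Y →L[ℂ] Y →L[ℂ] Y}

theorem norm_pow_apply_le (hC : ∀ y z, ‖C y z‖ ≤ ‖y‖ * ‖z‖) (y z : Y) (k : ℕ) :
    ‖(C y ^ k) z‖ ≤ ‖y‖ ^ k * ‖z‖ := by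
  induction k with
  | zero => simp
  | succ k ih =>
    rw [pow_succ', mul_apply_eq_comp, pow_succ', mul_assoc]
    exact (hC _ _).trans (by gcongr)

/-- On the ball of radius `1/2` the powers have Lipschitz constant at most `1`: each telescoping
step halves the previous difference and adds at most half of `‖y - y'‖ * ‖z‖`. -/
theorem norm_pow_apply_sub_le (hC : ∀ y z, ‖C y z‖ ≤ ‖y‖ * ‖z‖) {y y' : Y}
    (hy : ‖y‖ ≤ 1 / 2) (hy' : ‖y'‖ ≤ 1 / 2) (z : Y) (k : ℕ) :
    ‖(C y ^ k) z - (C y' ^ k) z‖ ≤ ‖y - y'‖ * ‖z‖ := by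
  induction k with
  | zero => simp only [pow_zero, sub_self, norm_zero]; positivity
  | succ k ih =>
    have e : (C y ^ (k + 1)) z - (C y' ^ (k + 1)) z =
        C (y - y') ((C y ^ k) z) + C y' ((C y ^ k) z - (C y' ^ k) z) := by
      rw [pow_succ', pow_succ', mul_apply_eq_comp, mul_apply_eq_comp,
        map_sub, map_sub, sub_apply]
      abel
    rw [e]
    have h1 : ‖C (y - y') ((C y ^ k) z)‖ ≤ ‖y - y'‖ * (‖y‖ ^ k * ‖z‖) :=
      (hC _ _).trans (by gcongr; exact norm_pow_apply_le hC y z k)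
    have h2 := hC y' ((C y ^ k) z - (C y' ^ k) z)
    refine (norm_add_le _ _).trans ((add_le_add h1 h2).trans ?_)
    have hd : 0 ≤ ‖y - y'‖ * ‖z‖ := by positivity
    rcases k with _ | k
    · simp
    · have h3 : ‖y‖ ^ (k + 1) ≤ 1 / 2 := by
        calc ‖y‖ ^ (k + 1) ≤ (1 / 2) ^ (k + 1) := by gcongr
          _ ≤ (1 / 2) ^ 1 := pow_le_pow_of_le_one (by norm_num) (by norm_num) (by omega)
          _ = 1 / 2 := pow_one _
      calc _ = ‖y‖ ^ (k + 1) * (‖y - y'‖ * ‖z‖) +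
            ‖y'‖ * ‖(C y ^ (k + 1)) z - (C y' ^ (k + 1)) z‖ := by ring
        _ ≤ 1 / 2 * (‖y - y'‖ * ‖z‖) + 1 / 2 * (‖y - y'‖ * ‖z‖) := by gcongr
        _ = _ := by ring

theorem norm_sin_term_sub_le (hC : ∀ y z, ‖C y z‖ ≤ ‖y‖ * ‖z‖) {y y' : Y}
    (hy : ‖y‖ ≤ 1 / 2) (hy' : ‖y'‖ ≤ 1 / 2) (k : ℕ) :
    ‖((-1) ^ k / (2 * k + 3).factorial : ℂ) • (C y ^ (2 * k + 2)) y -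
      ((-1) ^ k / (2 * k + 3).factorial : ℂ) • (C y' ^ (2 * k + 2)) y'‖ ≤
      ‖y - y'‖ / 4 * (1 / 2) ^ k := by
  rw [← smul_sub, norm_smul]
  have hfac : (4 * 2 ^ k : ℝ) ≤ (2 * k + 3).factorial := by
    have : 4 * 2 ^ k ≤ (2 * k + 3).factorial := by
      induction k with
      | zero => decide
      | succ k ih =>
        rw [show 2 * (k + 1) + 3 = (2 * k + 3) + 1 + 1 by ring, Nat.factorial_succ,
          Nat.factorial_succ, pow_succ]
        nlinarith [Nat.factorial_pos (2 * k + 3),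
          Nat.mul_le_mul_left (2 * k + 3 + 1 + 1) (Nat.le_mul_of_pos_left
            (2 * k + 3).factorial (Nat.succ_pos (2 * k + 3)))]
    exact_mod_cast this
  have hn : ‖((-1) ^ k / (2 * k + 3).factorial : ℂ)‖ ≤ (1 / 4) * (1 / 2) ^ k := by
    rw [norm_div, norm_pow, norm_neg, norm_one, one_pow, Complex.norm_natCast, div_pow, one_pow,
      div_mul_div_comm, one_mul]
    exact one_div_le_one_div_of_le (by positivity) hfac
  have hd : ‖(C y ^ (2 * k + 2)) y - (C y' ^ (2 * k + 2)) y'‖ ≤ ‖y - y'‖ := by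
    have e : (C y ^ (2 * k + 2)) y - (C y' ^ (2 * k + 2)) y' =
        ((C y ^ (2 * k + 2)) y - (C y' ^ (2 * k + 2)) y) + (C y' ^ (2 * k + 2)) (y - y') := by
      rw [map_sub]; abel
    rw [e]
    have h1 := norm_pow_apply_sub_le hC hy hy' y (2 * k + 2)
    have h2 := norm_pow_apply_le hC y' (y - y') (2 * k + 2)
    have h3 : ‖y'‖ ^ (2 * k + 2) ≤ 1 / 2 := by
      calc ‖y'‖ ^ (2 * k + 2) ≤ (1 / 2) ^ (2 * k + 2) := by gcongr
        _ ≤ (1 / 2) ^ 1 := pow_le_pow_of_le_one (by norm_num) (by norm_num) (by omega)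
        _ = 1 / 2 := pow_one _
    refine (norm_add_le _ _).trans ?_
    nlinarith [norm_nonneg (y - y')]
  calc _ ≤ (1 / 4) * (1 / 2) ^ k * ‖y - y'‖ := by gcongr
    _ = _ := by ring

theorem norm_pow_apply_le_norm (hC : ∀ y z, ‖C y z‖ ≤ ‖y‖ * ‖z‖) {y : Y} (hy : ‖y‖ ≤ 1 / 2)
    (z : Y) (k : ℕ) : ‖(C y ^ k) z‖ ≤ ‖z‖ :=
  (norm_pow_apply_le hC y z k).trans (mul_le_of_le_one_left (norm_nonneg _)
    (pow_le_one₀ (norm_nonneg _) (hy.trans (by norm_num))))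

variable {b : ℕ → Y}

/-- The two parts contribute at most `1/8` and `‖y‖/2 ≤ 1/4`. -/
theorem norm_zeroMap_le (hC : ∀ y z, ‖C y z‖ ≤ ‖y‖ * ‖z‖)
    (hb : Summable fun k => ‖b k‖) (hb' : ∑' k, ‖b k‖ ≤ 1 / 8) {y : Y}
    (hy : ‖y‖ ≤ 1 / 2) : ‖zeroMap C b y‖ ≤ 1 / 2 := by
  have h1 : ‖∑' k, (C y ^ k) (b k)‖ ≤ ∑' k, ‖b k‖ :=
    tsum_of_norm_bounded hb.hasSum fun k => norm_pow_apply_le_norm hC hy _ k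
  have h2 := tsum_of_norm_bounded (hasSum_geometric_two.mul_left (‖y‖ / 4))
    fun k => (by simpa using norm_sin_term_sub_le hC hy (y' := 0) (by simp) k :
      ‖((-1) ^ k / (2 * k + 3).factorial : ℂ) • (C y ^ (2 * k + 2)) y‖ ≤ ‖y‖ / 4 * (1 / 2) ^ k)
  rw [zeroMap]
  refine (norm_add_le _ _).trans ?_
  rw [norm_neg]
  linarith

variable [CompleteSpace Y]

theorem summable_zeroMap_fst (hC : ∀ y z, ‖C y z‖ ≤ ‖y‖ * ‖z‖)
    (hb : Summable fun k => ‖b k‖) {y : Y} (hy : ‖y‖ ≤ 1 / 2) :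
    Summable fun k => (C y ^ k) (b k) :=
  Summable.of_norm_bounded hb fun k => norm_pow_apply_le_norm hC hy _ k

theorem summable_zeroMap_snd (hC : ∀ y z, ‖C y z‖ ≤ ‖y‖ * ‖z‖) {y : Y} (hy : ‖y‖ ≤ 1 / 2) :
    Summable fun k : ℕ => ((-1) ^ k / (2 * k + 3).factorial : ℂ) • (C y ^ (2 * k + 2)) y := by
  refine Summable.of_norm_bounded (summable_geometric_two.mul_left (‖y‖ / 4)) fun k => ?_
  have := norm_sin_term_sub_le hC hy (y' := 0) (by simp) k
  simpa using this

/-- The constant is `1/8` from the `b`-series plus `(1/4) ∑ 2⁻ᵏ = 1/2` from the sine remainder. -/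
theorem norm_zeroMap_sub_le (hC : ∀ y z, ‖C y z‖ ≤ ‖y‖ * ‖z‖)
    (hb : Summable fun k => ‖b k‖) (hb' : ∑' k, ‖b k‖ ≤ 1 / 8) {y y' : Y}
    (hy : ‖y‖ ≤ 1 / 2) (hy' : ‖y'‖ ≤ 1 / 2) :
    ‖zeroMap C b y - zeroMap C b y'‖ ≤ 5 / 8 * ‖y - y'‖ := by
  have e : zeroMap C b y - zeroMap C b y' =
      -(∑' k, ((C y ^ k) (b k) - (C y' ^ k) (b k))) +
      ∑' k : ℕ, (((-1) ^ k / (2 * k + 3).factorial : ℂ) • (C y ^ (2 * k + 2)) y -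
        ((-1) ^ k / (2 * k + 3).factorial : ℂ) • (C y' ^ (2 * k + 2)) y') := by
    rw [(summable_zeroMap_fst hC hb hy).tsum_sub (summable_zeroMap_fst hC hb hy'),
      (summable_zeroMap_snd hC hy).tsum_sub (summable_zeroMap_snd hC hy'), zeroMap, zeroMap]
    abel
  have h1 : ‖∑' k, ((C y ^ k) (b k) - (C y' ^ k) (b k))‖ ≤ ‖y - y'‖ * ∑' k, ‖b k‖ :=
    tsum_of_norm_bounded (hb.hasSum.mul_left _) fun k => norm_pow_apply_sub_le hC hy hy' _ k
  have h2 := tsum_of_norm_bounded (hasSum_geometric_two.mul_left (‖y - y'‖ / 4))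
    fun k => norm_sin_term_sub_le hC hy hy' k
  rw [e]
  refine (norm_add_le _ _).trans ?_
  rw [norm_neg]
  nlinarith [norm_nonneg (y - y')]

theorem exists_zeroMap_eq (hC : ∀ y z, ‖C y z‖ ≤ ‖y‖ * ‖z‖)
    (hb : Summable fun k => ‖b k‖) (hb' : ∑' k, ‖b k‖ ≤ 1 / 8) :
    ∃ y, ‖y‖ ≤ 1 / 2 ∧ zeroMap C b y = y := by
  have hmaps : MapsTo (zeroMap C b) (Metric.closedBall 0 (1 / 2)) (Metric.closedBall 0 (1 / 2)) :=
    fun y hy => by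
      rw [mem_closedBall_zero_iff] at hy ⊢
      exact norm_zeroMap_le hC hb hb' hy
  have hlip : ContractingWith (5 / 8) (hmaps.restrict (zeroMap C b) _ _) := by
    refine ⟨by rw [← NNReal.coe_lt_coe]; norm_num, LipschitzWith.of_dist_le_mul fun u v => ?_⟩
    rw [Subtype.dist_eq, Subtype.dist_eq, dist_eq_norm, dist_eq_norm]
    have := norm_zeroMap_sub_le hC hb hb' (mem_closedBall_zero_iff.1 u.2)
      (mem_closedBall_zero_iff.1 v.2)
    simpa using this
  obtain ⟨y, hy, hy', -⟩ := ContractingWith.exists_fixedPoint' Metric.isClosed_closedBall.isComplete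
    hmaps hlip (x := 0) (by simp) (edist_ne_top _ _)
  exact ⟨y, mem_closedBall_zero_iff.1 hy, hy'⟩

theorem zeroMap_fixedPoint_unique (hC : ∀ y z, ‖C y z‖ ≤ ‖y‖ * ‖z‖)
    (hb : Summable fun k => ‖b k‖) (hb' : ∑' k, ‖b k‖ ≤ 1 / 8) {y y' : Y}
    (hy : ‖y‖ ≤ 1 / 2) (hy' : ‖y'‖ ≤ 1 / 2) (h : zeroMap C b y = y)
    (h' : zeroMap C b y' = y') : y = y' := by
  have := norm_zeroMap_sub_le hC hb hb' hy hy'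
  rw [h, h'] at this
  have h0 : ‖y - y'‖ ≤ 0 := by linarith [norm_nonneg (y - y')]
  exact sub_eq_zero.1 (norm_le_zero_iff.1 h0)

/-- A continuous multiplicative functional passes through both series, so it carries a fixed point
in `Y` to a fixed point of the scalar problem. -/
theorem map_zeroMap (hC : ∀ y z, ‖C y z‖ ≤ ‖y‖ * ‖z‖)
    (hb : Summable fun k => ‖b k‖) {y : Y} (hy : ‖y‖ ≤ 1 / 2) (χ : Y →L[ℂ] ℂ)
    (hχ : ∀ y z, χ (C y z) = χ y * χ z) :
    χ (zeroMap C b y) = zeroMap (ContinuousLinearMap.mul ℂ ℂ) (fun k => χ (b k)) (χ y) := by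
  have hpow : ∀ (k : ℕ) (z : Y), χ ((C y ^ k) z) =
      (ContinuousLinearMap.mul ℂ ℂ (χ y) ^ k) (χ z) := by
    intro k
    induction k with
    | zero => intro z; simp
    | succ k ih =>
      intro z
      rw [pow_succ', pow_succ', mul_apply_eq_comp, mul_apply_eq_comp, hχ,
        ih, ContinuousLinearMap.mul_apply']
  rw [zeroMap, zeroMap, map_add, map_neg, χ.map_tsum (summable_zeroMap_fst hC hb hy),
    χ.map_tsum (summable_zeroMap_snd hC hy)]
  simp only [map_smul, hpow]

theorem mul_pow_apply (y z : ℂ) (k : ℕ) :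
    (ContinuousLinearMap.mul ℂ ℂ y ^ k) z = y ^ k * z := by
  induction k with
  | zero => simp
  | succ k ih =>
    rw [pow_succ', mul_apply_eq_comp, ih, ContinuousLinearMap.mul_apply', pow_succ']
    ring

theorem zeroMap_mul_eq (β : ℕ → ℂ) (y : ℂ) :
    zeroMap (ContinuousLinearMap.mul ℂ ℂ) β y = -∑' k, y ^ k * β k + (y - Complex.sin y) := by
  rw [zeroMap]
  simp only [mul_pow_apply, smul_eq_mul]
  congr 1
  have h := (hasSum_nat_add_iff' 1).2 (Complex.hasSum_sin y)
  simp only [Finset.range_one, Finset.sum_singleton] at h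
  have h' := h.neg
  have e : -(Complex.sin y - (-1) ^ 0 * y ^ (2 * 0 + 1) / ((2 * 0 + 1).factorial : ℂ)) =
      y - Complex.sin y := by simp
  rw [e] at h'
  rw [← h'.tsum_eq]
  refine tsum_congr fun k => ?_
  rw [show 2 * (k + 1) + 1 = 2 * k + 3 by ring, show 2 * k + 3 = 2 * k + 2 + 1 by ring, pow_succ y,
    pow_succ (-1 : ℂ) k]
  ring

end ZeroMap

end

/-! ### The convolution algebra `L_p` of the circle -/

section

/-- `Lp` of the circle of length one. -/
abbrev LpCircle (p : ENNReal) : Type :=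
  Lp ℂ p (AddCircle.haarAddCircle : Measure UnitAddCircle)

theorem memLp_liftIoc {p : ENNReal} {f : ℝ → ℂ} (hf : MemLp f p mu01) :
    MemLp (AddCircle.liftIoc (1 : ℝ) 0 f) p (AddCircle.haarAddCircle : Measure UnitAddCircle) := by
  rw [memLp_haarAddCircle_iff]
  refine MemLp.memLp_liftIoc ?_
  rwa [zero_add, Measure.restrict_congr_set Ioo_ae_eq_Ioc.symm]

variable {p : ENNReal} [Fact (1 ≤ p)]

/-- Translation on `Lp` of the circle. -/
def translate (p : ENNReal) [Fact (1 ≤ p)] (s : UnitAddCircle) : LpCircle p →ₗᵢ[ℂ] LpCircle p :=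
  Lp.compMeasurePreservingₗᵢ ℂ (fun x => x - s)
    (measurePreserving_sub_right AddCircle.haarAddCircle s)

theorem translate_ae (s : UnitAddCircle) (z : LpCircle p) :
    translate p s z =ᵐ[AddCircle.haarAddCircle] fun x => z (x - s) :=
  Lp.coeFn_compMeasurePreserving z (measurePreserving_sub_right AddCircle.haarAddCircle s)

theorem continuous_translate (hp : p ≠ ⊤) (z : LpCircle p) :
    Continuous fun s => translate p s z := by
  have hg : Continuous fun s : UnitAddCircle =>
      (⟨fun x => x - s, by fun_prop⟩ : C(UnitAddCircle, UnitAddCircle)) :=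
    ContinuousMap.continuous_of_continuous_uncurry _ (by
      simp only [Function.uncurry_def, ContinuousMap.coe_mk]; fun_prop)
  exact (continuous_const (y := z)).compMeasurePreservingLp hg
    (fun s => measurePreserving_sub_right AddCircle.haarAddCircle s) hp

/-- The `n`-th Fourier coefficient as a functional. -/
def circleCoeff (p : ENNReal) [Fact (1 ≤ p)] (n : ℤ) : LpCircle p →L[ℂ] ℂ :=
  pairing p AddCircle.haarAddCircle (fun x => fourier (-n) x)
    (fourier (-n)).continuous.aestronglyMeasurable (fun x => by
      rw [fourier_apply, Circle.norm_coe])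

theorem circleCoeff_apply (n : ℤ) (y : LpCircle p) : circleCoeff p n y = fourierCoeff y n := rfl

theorem norm_circleCoeff_le (n : ℤ) (y : LpCircle p) : ‖circleCoeff p n y‖ ≤ ‖y‖ := by
  rw [circleCoeff]; apply norm_pairing_le

theorem circleCoeff_translate (n : ℤ) (s : UnitAddCircle) (z : LpCircle p) :
    circleCoeff p n (translate p s z) = fourier (-n) s * circleCoeff p n z := by
  rw [circleCoeff_apply, circleCoeff_apply, fourierCoeff_congr_ae (translate_ae s z), fourierCoeff,
    fourierCoeff, ← integral_const_mul]
  rw [← integral_sub_right_eq_self (fun x => fourier (-n) s * fourier (-n) x • z x)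
    s (μ := AddCircle.haarAddCircle)]
  refine integral_congr_ae (Filter.Eventually.of_forall fun x => ?_)
  have h : (fourier (-n) x : ℂ) = fourier (-n) s * fourier (-n) (x - s) := by
    rw [fourier_apply, fourier_apply, fourier_apply, ← Circle.coe_mul, ← AddCircle.toCircle_add,
      ← zsmul_add, add_sub_cancel]
  simp only [smul_eq_mul]
  rw [h]; ring

theorem integrable_smul_translate (hp : p ≠ ⊤) (y z : LpCircle p) :
    Integrable (fun s => y s • translate p s z) AddCircle.haarAddCircle := by
  refine Integrable.mono' ((integrable_of_Lp y).norm.mul_const ‖z‖)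
    ((Lp.aestronglyMeasurable y).smul (continuous_translate hp z).aestronglyMeasurable)
    (Filter.Eventually.of_forall fun s => ?_)
  rw [norm_smul, LinearIsometry.norm_map]

/-- Convolution on `Lp` of the circle. -/
def circleConv (hp : p ≠ ⊤) : LpCircle p →L[ℂ] LpCircle p →L[ℂ] LpCircle p :=
  LinearMap.mkContinuous₂
    (LinearMap.mk₂ ℂ (fun y z : LpCircle p => ∫ s, y s • translate p s z ∂AddCircle.haarAddCircle)
      (fun y y' z => by
        rw [← integral_add (integrable_smul_translate hp y z) (integrable_smul_translate hp y' z)]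
        refine integral_congr_ae ?_
        filter_upwards [Lp.coeFn_add y y'] with s hs
        rw [hs, Pi.add_apply, add_smul])
      (fun c y z => by
        rw [← integral_smul]
        refine integral_congr_ae ?_
        filter_upwards [Lp.coeFn_smul c y] with s hs
        rw [hs, Pi.smul_apply, smul_assoc])
      (fun y z z' => by
        rw [← integral_add (integrable_smul_translate hp y z) (integrable_smul_translate hp y z')]
        refine integral_congr_ae (Filter.Eventually.of_forall fun s => ?_)
        simp only [map_add, smul_add])
      (fun c y z => by
        rw [← integral_smul]
        refine integral_congr_ae (Filter.Eventually.of_forall fun s => ?_)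
        simp only [map_smul]
        rw [smul_comm])) 1 (fun y z => by
      rw [one_mul]
      refine (norm_integral_le_of_norm_le ((integrable_of_Lp y).norm.mul_const ‖z‖)
        (Filter.Eventually.of_forall fun s => ?_)).trans ?_
      · rw [norm_smul, LinearIsometry.norm_map]
      · rw [integral_mul_const]
        gcongr
        exact integral_norm_le_norm_Lp y)

theorem circleConv_apply (hp : p ≠ ⊤) (y z : LpCircle p) :
    circleConv hp y z = ∫ s, y s • translate p s z ∂AddCircle.haarAddCircle := rfl

theorem norm_circleConv_le (hp : p ≠ ⊤) (y z : LpCircle p) :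
    ‖circleConv hp y z‖ ≤ ‖y‖ * ‖z‖ := by
  rw [circleConv_apply]
  refine (norm_integral_le_of_norm_le ((integrable_of_Lp y).norm.mul_const ‖z‖)
    (Filter.Eventually.of_forall fun s => ?_)).trans ?_
  · rw [norm_smul, LinearIsometry.norm_map]
  · rw [integral_mul_const]
    gcongr
    exact integral_norm_le_norm_Lp y

/-- Translation by `s` multiplies the coefficient by the character at `s`, and integrating against
`y` produces the coefficient of `y`. -/
theorem circleCoeff_circleConv (hp : p ≠ ⊤) (n : ℤ) (y z : LpCircle p) :
    circleCoeff p n (circleConv hp y z) = circleCoeff p n y * circleCoeff p n z := by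
  rw [circleConv_apply, ← ContinuousLinearMap.integral_comp_comm _
    (integrable_smul_translate hp y z)]
  simp only [map_smul, circleCoeff_translate, smul_eq_mul]
  rw [circleCoeff_apply n y, fourierCoeff, ← integral_mul_const]
  refine integral_congr_ae (Filter.Eventually.of_forall fun s => ?_)
  simp only [smul_eq_mul]; ring

theorem circleCoeff_fourierLp (m n : ℤ) :
    circleCoeff p m (fourierLp p n) = if m = n then 1 else 0 := by
  rw [circleCoeff_apply, fourierCoeff_congr_ae (coeFn_fourierLp p n), fourierCoeff_fourier,
    Pi.single_apply]

theorem eventually_circleCoeff_eq_zero {y : LpCircle p}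
    (hy : y ∈ Submodule.span ℂ (range (fourierLp (T := 1) p))) :
    ∀ᶠ n in Filter.cofinite, circleCoeff p n y = 0 := by
  induction hy using Submodule.span_induction with
  | mem x h =>
    obtain ⟨m, rfl⟩ := h
    filter_upwards [Filter.eventually_cofinite_ne m] with n hn
    rw [circleCoeff_fourierLp, if_neg hn]
  | zero => simp
  | add x y _ _ hx hy =>
    filter_upwards [hx, hy] with n h1 h2
    rw [map_add, h1, h2, add_zero]
  | smul c x _ hx =>
    filter_upwards [hx] with n h
    rw [map_smul, h, smul_zero]

/-- Subtract a nearby trigonometric polynomial; these are dense for finite `p` and have finitely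
many nonzero coefficients. -/
theorem exists_small_same_tail (hp : p ≠ ⊤) (a : LpCircle p) {ε : ℝ} (hε : 0 < ε) :
    ∃ b : LpCircle p, ‖b‖ ≤ ε ∧ ∀ᶠ n in Filter.cofinite, circleCoeff p n b = circleCoeff p n a := by
  have h : a ∈ (Submodule.span ℂ (range (fourierLp (T := 1) p))).topologicalClosure := by
    rw [span_fourierLp_closure_eq_top hp]; trivial
  rw [← SetLike.mem_coe, Submodule.topologicalClosure_coe, Metric.mem_closure_iff] at h
  obtain ⟨P, hP, hd⟩ := h ε hε
  refine ⟨a - P, by rw [← dist_eq_norm]; exact hd.le, ?_⟩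
  filter_upwards [eventually_circleCoeff_eq_zero hP] with n hn
  rw [map_sub, hn, sub_zero]

/-- Only the first `K` terms are modified, the remaining ones having total norm below `ε/2`. This
keeps the exceptional set of frequencies finite and common to all `k`. -/
theorem exists_small_same_tail_seq (hp : p ≠ ⊤) {a : ℕ → LpCircle p}
    (ha : Summable fun k => ‖a k‖) {ε : ℝ} (hε : 0 < ε) :
    ∃ b : ℕ → LpCircle p, (Summable fun k => ‖b k‖) ∧ ∑' k, ‖b k‖ ≤ ε ∧
      ∀ᶠ n in Filter.cofinite, ∀ k, circleCoeff p n (b k) = circleCoeff p n (a k) := by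
  obtain ⟨K, hK⟩ := ((tendsto_sum_nat_add fun k => ‖a k‖).eventually_lt_const
    (half_pos hε)).exists
  have hδ : 0 < ε / 2 / (K + 1) := by positivity
  choose c hc hc' using fun k => exists_small_same_tail hp (a k) hδ
  refine ⟨fun k => if k < K then c k else a k, ?_, ?_, ?_⟩
  · rw [← summable_nat_add_iff K]
    simpa using (summable_nat_add_iff K).2 ha
  · have hs : Summable fun k => ‖if k < K then c k else a k‖ := by
      rw [← summable_nat_add_iff K]
      simpa using (summable_nat_add_iff K).2 ha
    rw [← hs.sum_add_tsum_nat_add K]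
    have h1 : ∑ k ∈ Finset.range K, ‖if k < K then c k else a k‖ ≤ ε / 2 := by
      calc _ ≤ ∑ _k ∈ Finset.range K, ε / 2 / (K + 1) := by
            refine Finset.sum_le_sum fun k hk => ?_
            rw [if_pos (Finset.mem_range.1 hk)]; exact hc k
        _ = K * (ε / 2 / (K + 1)) := by simp
        _ ≤ (K + 1) * (ε / 2 / (K + 1)) := by gcongr; linarith
        _ = ε / 2 := by field
    have h2 : ∑' k, ‖if k + K < K then c (k + K) else a (k + K)‖ ≤ ε / 2 := by
      simpa using hK.le
    linarith
  · have : ∀ᶠ n in Filter.cofinite, ∀ k ∈ Finset.range K,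
        circleCoeff p n (c k) = circleCoeff p n (a k) :=
      (Filter.eventually_all_finset _).2 fun k _ => hc' k
    filter_upwards [this] with n hn k
    split_ifs with h
    · exact hn k (Finset.mem_range.2 h)
    · rfl

theorem exists_circleCoeff_eq_of_eventually (y : LpCircle p) {ρ : ℤ → ℂ}
    (h : ∀ᶠ n in Filter.cofinite, circleCoeff p n y = ρ n) :
    ∃ y' : LpCircle p, ∀ n, circleCoeff p n y' = ρ n := by
  have hfin : {n | ¬ circleCoeff p n y = ρ n}.Finite := h
  refine ⟨y + ∑ m ∈ hfin.toFinset, (ρ m - circleCoeff p m y) • fourierLp p m, fun n => ?_⟩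
  rw [map_add, map_sum]
  simp only [map_smul, circleCoeff_fourierLp, smul_eq_mul, mul_ite, mul_one, mul_zero]
  rw [Finset.sum_ite_eq]
  split_ifs with hn
  · ring
  · rw [Set.Finite.mem_toFinset] at hn
    simpa using hn

theorem fourier_neg_coe (n : ℤ) (x : ℝ) : (fourier (-n) (x : UnitAddCircle) : ℂ) =
    Complex.exp (-(2 * Real.pi * n * x) * Complex.I) := by
  rw [fourier_coe_apply]
  congr 1
  push_cast; ring

theorem circleCoeff_toLp_liftIoc {f : ℝ → ℂ} (hf : MemLp f p mu01) (n : ℤ) :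
    circleCoeff p n (memLp_liftIoc hf).toLp = fourierCoef f n := by
  rw [circleCoeff_apply, fourierCoeff_congr_ae (MemLp.coeFn_toLp _),
    fourierCoeff_eq_intervalIntegral _ _ 0, fourierCoef, ← integral_Ioc_eq_integral_Ioo,
    intervalIntegral.integral_of_le (by norm_num), zero_add, div_one, one_smul]
  refine setIntegral_congr_fun measurableSet_Ioc fun x hx => ?_
  simp only [smul_eq_mul]
  rw [AddCircle.liftIoc_coe_apply (by rwa [zero_add]), fourier_neg_coe]

theorem exists_fourierCoef_eq (y : LpCircle p) :
    ∃ g : ℝ → ℂ, MemLp g p mu01 ∧ ∀ n, fourierCoef g n = circleCoeff p n y := by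
  refine ⟨fun x => y (x : UnitAddCircle), ?_, fun n => ?_⟩
  · have h := (memLp_haarAddCircle_iff.1 (Lp.memLp y)).comp_measurePreserving
      (UnitAddCircle.measurePreserving_mk 0)
    rw [zero_add, Measure.restrict_congr_set Ioo_ae_eq_Ioc.symm] at h
    exact h
  · rw [circleCoeff_apply, fourierCoeff_eq_intervalIntegral _ _ 0, fourierCoef,
      ← integral_Ioc_eq_integral_Ioo, intervalIntegral.integral_of_le (by norm_num), zero_add,
      div_one, one_smul]
    refine setIntegral_congr_fun measurableSet_Ioc fun x hx => ?_
    simp only [smul_eq_mul]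
    rw [fourier_neg_coe]

end

/-! ### Expansion of the phase and solution of the sine equation -/

section

/-- The coefficient functions of the expansion of `exp (ρ (1 - 2x) i) f x` in powers of `ρ`. -/
def expansionTerm (f : ℝ → ℂ) (k : ℕ) (x : ℝ) : ℂ :=
  (((1 - 2 * x : ℝ) : ℂ) * Complex.I) ^ k / k.factorial * f x

theorem norm_expansionTerm_le (f : ℝ → ℂ) (k : ℕ) {x : ℝ} (hx : x ∈ Icc (0 : ℝ) 1) :
    ‖expansionTerm f k x‖ ≤ 1 / k.factorial * ‖f x‖ := by
  rw [expansionTerm, norm_mul, norm_div, norm_pow, norm_mul, Complex.norm_I, mul_one,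
    Complex.norm_real, Complex.norm_natCast]
  have : ‖1 - 2 * x‖ ^ k ≤ 1 := pow_le_one₀ (norm_nonneg _) (by
    rw [Real.norm_eq_abs, abs_le]; constructor <;> linarith [hx.1, hx.2])
  gcongr

variable {p : ENNReal}

theorem memLp_expansionTerm {f : ℝ → ℂ} (hf : MemLp f p mu01) (k : ℕ) :
    MemLp (expansionTerm f k) p mu01 := by
  have hm : AEStronglyMeasurable (expansionTerm f k) mu01 :=
    (Continuous.aestronglyMeasurable (by fun_prop)).mul hf.aestronglyMeasurable
  refine hf.of_le_mul (c := 1 / k.factorial) hm ?_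
  filter_upwards [ae_restrict_mem measurableSet_Ioo] with x hx
  exact norm_expansionTerm_le f k (Ioo_subset_Icc_self hx)

theorem norm_exp_fourier (n : ℤ) (x : ℝ) :
    ‖Complex.exp (-(2 * Real.pi * n * x) * Complex.I)‖ = 1 := by
  have : (-(2 * Real.pi * n * x) * Complex.I : ℂ) =
    ((-(2 * Real.pi * n * x) : ℝ) : ℂ) * Complex.I := by push_cast; ring
  rw [this, Complex.norm_exp_ofReal_mul_I]

theorem hasSum_fourierCoef_expansionTerm {f : ℝ → ℂ} (hf : Integrable f mu01) (ρ : ℝ) (n : ℤ) :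
    HasSum (fun k => (ρ : ℂ) ^ k * fourierCoef (expansionTerm f k) n)
      (fourierCoef (fun x => Complex.exp ((ρ * (1 - 2 * x) : ℝ) * Complex.I) * f x) n) := by
  set F : ℕ → ℝ → ℂ := fun k x => Complex.exp (-(2 * Real.pi * n * x) * Complex.I) *
    ((ρ : ℂ) ^ k * expansionTerm f k x) with hF
  have hbound : ∀ k, ∀ᵐ x ∂mu01, ‖F k x‖ ≤ |ρ| ^ k / k.factorial * ‖f x‖ := by
    intro k
    filter_upwards [ae_restrict_mem measurableSet_Ioo] with x hx
    rw [hF]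
    simp only
    rw [norm_mul, norm_exp_fourier, one_mul, norm_mul, norm_pow, Complex.norm_real,
      Real.norm_eq_abs, div_eq_mul_one_div, mul_assoc]
    exact mul_le_mul_of_nonneg_left (norm_expansionTerm_le f k (Ioo_subset_Icc_self hx))
      (by positivity)
  have hint : ∀ k, Integrable (F k) mu01 := by
    intro k
    refine (hf.norm.const_mul (|ρ| ^ k / k.factorial)).mono' ?_ (hbound k)
    exact (Continuous.aestronglyMeasurable (by fun_prop)).mul (aestronglyMeasurable_const.mul
      ((Continuous.aestronglyMeasurable (by fun_prop)).mul hf.aestronglyMeasurable))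
  have hsum : Summable fun k => ∫ x, ‖F k x‖ ∂mu01 := by
    refine Summable.of_nonneg_of_le (fun k => integral_nonneg fun x => norm_nonneg _) (fun k => ?_)
      ((Real.summable_pow_div_factorial |ρ|).mul_right (∫ x, ‖f x‖ ∂mu01))
    rw [← integral_const_mul]
    exact integral_mono_ae (hint k).norm (hf.norm.const_mul _) (hbound k)
  have h := hasSum_integral_of_summable_integral_norm hint hsum
  have e : ∀ x, ∑' k, F k x = Complex.exp (-(2 * Real.pi * n * x) * Complex.I) *
      (Complex.exp ((ρ * (1 - 2 * x) : ℝ) * Complex.I) * f x) := by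
    intro x
    have h1 := NormedSpace.expSeries_div_hasSum_exp (((ρ * (1 - 2 * x) : ℝ) : ℂ) * Complex.I)
    rw [← Complex.exp_eq_exp_ℂ] at h1
    refine HasSum.tsum_eq ?_
    convert! (h1.mul_right (f x)).mul_left
      (Complex.exp (-(2 * Real.pi * n * x) * Complex.I)) using 2 with k
    simp only [hF, expansionTerm]
    push_cast
    rw [mul_assoc (ρ : ℂ) _ Complex.I, mul_pow (ρ : ℂ)]
    ring
  simp only [e] at h
  convert! h using 2 with k
  rw [fourierCoef, ← integral_const_mul]
  refine integral_congr_ae (Filter.Eventually.of_forall fun x => ?_)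
  simp only [hF]; ring

theorem norm_toLp_expansionTerm_le {f : ℝ → ℂ} (hf : MemLp f p mu01) (k : ℕ) :
    ‖(memLp_liftIoc (memLp_expansionTerm hf k)).toLp‖ ≤
      1 / k.factorial * ‖(memLp_liftIoc hf).toLp‖ := by
  refine Lp.norm_le_mul_norm_of_ae_le_mul ?_
  filter_upwards [MemLp.coeFn_toLp (memLp_liftIoc (memLp_expansionTerm hf k)),
    MemLp.coeFn_toLp (memLp_liftIoc hf)] with x h1 h2
  rw [h1, h2]
  have hx : x ∈ ((↑) : ℝ → UnitAddCircle) '' Ioc 0 (0 + 1) := by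
    rw [AddCircle.coe_image_Ioc_eq]; trivial
  obtain ⟨y, hy, rfl⟩ := hx
  rw [AddCircle.liftIoc_coe_apply hy, AddCircle.liftIoc_coe_apply hy]
  rw [zero_add] at hy
  exact norm_expansionTerm_le f k (Ioc_subset_Icc_self hy)

variable [Fact (1 ≤ p)]

/-- Small solutions of `sin ρₙ + eₙ(exp(i ρₙ (1 - 2x)) f) = 0` are Fourier coefficients of an
`Lp` function. -/
theorem exists_fourierCoef_eq_of_sin_add_eq_zero (hp : p ≠ ⊤) {f : ℝ → ℂ} (hf : MemLp f p mu01)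
    {ρ : ℤ → ℝ} (hρ : Filter.Tendsto ρ Filter.cofinite (nhds 0))
    (h : ∀ n, Complex.sin (ρ n) + fourierCoef
      (fun x => Complex.exp ((ρ n * (1 - 2 * x) : ℝ) * Complex.I) * f x) n = 0) :
    ∃ g : ℝ → ℂ, MemLp g p mu01 ∧ ∀ n, fourierCoef g n = ρ n := by
  let a : ℕ → LpCircle p := fun k => (memLp_liftIoc (memLp_expansionTerm hf k)).toLp
  have hfac : Summable fun k : ℕ => (1 : ℝ) / k.factorial := by
    simpa using Real.summable_pow_div_factorial 1
  have ha : Summable fun k => ‖a k‖ :=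
    Summable.of_nonneg_of_le (fun _ => norm_nonneg _) (norm_toLp_expansionTerm_le hf)
      (hfac.mul_right _)
  obtain ⟨b, hb, hb', htail⟩ := exists_small_same_tail_seq hp ha (ε := 1 / 8) (by norm_num)
  obtain ⟨y, hy, hfix⟩ := exists_zeroMap_eq (norm_circleConv_le hp) hb hb'
  have hmain : ∀ᶠ n in Filter.cofinite, circleCoeff p n y = ρ n := by
    have hsmall := (hρ.norm.eventually_le_const (u := 1 / 2) (by simp))
    filter_upwards [htail, hsmall] with n hn hρn
    have hβ : ∀ k, ‖circleCoeff p n (b k)‖ ≤ ‖b k‖ := fun k => norm_circleCoeff_le n (b k)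
    have hβs : Summable fun k => ‖circleCoeff p n (b k)‖ :=
      Summable.of_nonneg_of_le (fun _ => norm_nonneg _) hβ hb
    -- The `n`-th coefficient of `y` and `ρ n` are both fixed points of one scalar contraction on
    -- the disc of radius `1/2`, hence equal.
    refine zeroMap_fixedPoint_unique (C := ContinuousLinearMap.mul ℂ ℂ)
      (b := fun k => circleCoeff p n (b k)) (fun y z => by simp) hβs
      ((hβs.tsum_le_tsum hβ hb).trans hb') ((norm_circleCoeff_le n y).trans hy)
      (by simpa using hρn) ?_ ?_
    · rw [← map_zeroMap (norm_circleConv_le hp) hb hy (circleCoeff p n)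
        (circleCoeff_circleConv hp n), hfix]
    · rw [zeroMap_mul_eq]
      have hs := hasSum_fourierCoef_expansionTerm (hf.integrable Fact.out) (ρ n) n
      have e : ∑' k, (ρ n : ℂ) ^ k * circleCoeff p n (b k) = fourierCoef
          (fun x => Complex.exp ((ρ n * (1 - 2 * x) : ℝ) * Complex.I) * f x) n := by
        rw [← hs.tsum_eq]
        refine tsum_congr fun k => ?_
        rw [hn k, circleCoeff_toLp_liftIoc (memLp_expansionTerm hf k)]
      rw [e]
      linear_combination -(h n)
  obtain ⟨y', hy'⟩ := exists_circleCoeff_eq_of_eventually y hmain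
  obtain ⟨g, hg, hg'⟩ := exists_fourierCoef_eq y'
  exact ⟨g, hg, fun n => by rw [hg', hy']⟩

end

/-! ### From a real amplitude to the sine equation -/

section

open scoped ComplexConjugate

/-- Reflection in `1/2` works because the frequency is an integer: `exp(2πin) = 1`. -/
theorem conj_fourierCoef (g : ℝ → ℂ) (n : ℤ) :
    conj (fourierCoef g n) = fourierCoef (fun x => conj (g (1 - x))) n := by
  rw [fourierCoef, fourierCoef, ← integral_conj, ← integral_Ioc_eq_integral_Ioo,
    ← integral_Ioc_eq_integral_Ioo, ← intervalIntegral.integral_of_le zero_le_one,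
    ← intervalIntegral.integral_of_le zero_le_one]
  have h := intervalIntegral.integral_comp_sub_left (a := 0) (b := 1) (fun x : ℝ =>
    conj (Complex.exp (-(2 * Real.pi * n * x) * Complex.I) * g x)) 1
  rw [sub_self, sub_zero] at h
  rw [← h]
  refine intervalIntegral.integral_congr fun x _ => ?_
  simp only [map_mul]
  congr 1
  rw [← Complex.exp_conj]
  simp only [map_mul, map_neg, Complex.conj_ofReal, Complex.conj_I, map_ofNat, map_intCast]
  rw [Complex.exp_eq_exp_iff_exists_int]
  exact ⟨n, by push_cast; ring⟩

theorem fourierCoef_const_mul (c : ℂ) (g : ℝ → ℂ) (n : ℤ) :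
    fourierCoef (fun x => c * g x) n = c * fourierCoef g n := by
  rw [fourierCoef, fourierCoef, ← integral_const_mul]
  refine integral_congr_ae (Filter.Eventually.of_forall fun x => ?_)
  simp only; ring

theorem fourierCoef_sub {g g' : ℝ → ℂ} (hg : Integrable g mu01) (hg' : Integrable g' mu01)
    (n : ℤ) : fourierCoef (fun x => g x - g' x) n = fourierCoef g n - fourierCoef g' n := by
  have hb : ∀ x : ℝ, ‖Complex.exp (-(2 * Real.pi * n * x) * Complex.I)‖ ≤ 1 :=
    fun x => (norm_exp_fourier n x).le
  rw [fourierCoef, fourierCoef, fourierCoef, ← integral_sub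
    (hg.bdd_mul (by fun_prop) (Filter.Eventually.of_forall hb))
    (hg'.bdd_mul (by fun_prop) (Filter.Eventually.of_forall hb))]
  refine integral_congr_ae (Filter.Eventually.of_forall fun x => ?_)
  simp only; ring

theorem memLp_phase_mul {p : ENNReal} {K : ℝ → ℂ} {μ : Measure ℝ} (hK : MemLp K p μ) {φ : ℝ → ℝ}
    (hφ : Continuous φ) : MemLp (fun x => Complex.exp (φ x * Complex.I) * K x) p μ := by
  refine hK.of_le ((Continuous.aestronglyMeasurable (by fun_prop)).mul hK.aestronglyMeasurable)
    (Filter.Eventually.of_forall fun x => ?_)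
  rw [norm_mul, Complex.norm_exp_ofReal_mul_I, one_mul]

variable {p : ENNReal} [Fact (1 ≤ p)]

/-- The phase `exp(iρ(1 - 2x))` is invariant under conjugation combined with `x ↦ 1 - x`. The
imaginary part therefore acts on `K` alone, giving `f = (K - conj K(1 - ·)) / 2i`, the same for
every `n`. -/
theorem exists_fourierCoef_eq_of_im_eq_zero (hp : p ≠ ⊤) {K : ℝ → ℂ}
    (hK : MemLp K p (volume : Measure ℝ)) {ρ : ℤ → ℝ}
    (hρ : Filter.Tendsto ρ Filter.cofinite (nhds 0))
    (h : ∀ n, (Complex.exp (ρ n * Complex.I) * (1 + fourierCoef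
      (fun x => Complex.exp ((-(2 * ρ n * x) : ℝ) * Complex.I) * K x) n)).im = 0) :
    ∃ g : ℝ → ℂ, MemLp g p mu01 ∧ ∀ n, fourierCoef g n = ρ n := by
  have hK' : MemLp (fun x => conj (K (1 - x))) p (volume : Measure ℝ) := by
    have h1 := hK.comp_measurePreserving (Measure.measurePreserving_sub_left volume (1 : ℝ))
    exact h1.star
  have hm : MemLp (fun x => (1 / (2 * Complex.I)) * (K x - conj (K (1 - x)))) p mu01 :=
    ((hK.sub hK').const_mul (1 / (2 * Complex.I))).restrict _
  refine exists_fourierCoef_eq_of_sin_add_eq_zero hp hm hρ fun n => ?_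
  set w : ℝ → ℂ := fun x => Complex.exp ((ρ n * (1 - 2 * x) : ℝ) * Complex.I) with hw
  have i1 : Integrable (fun x => w x * K x) mu01 :=
    (memLp_phase_mul (hK.restrict _) (by fun_prop)).integrable Fact.out
  have i2 : Integrable (fun x => w x * conj (K (1 - x))) mu01 :=
    (memLp_phase_mul (hK'.restrict _) (by fun_prop)).integrable Fact.out
  have e1 : fourierCoef (fun x => w x * ((1 / (2 * Complex.I)) * (K x - conj (K (1 - x))))) n =
      (1 / (2 * Complex.I)) * (fourierCoef (fun x => w x * K x) n -
        conj (fourierCoef (fun x => w x * K x) n)) := by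
    rw [conj_fourierCoef]
    have e : (fun x => conj (w (1 - x) * K (1 - x))) = fun x => w x * conj (K (1 - x)) := by
      ext x
      rw [map_mul]
      congr 1
      rw [hw]
      simp only
      rw [← Complex.exp_conj]
      congr 1
      simp only [map_mul, Complex.conj_ofReal, Complex.conj_I]
      push_cast; ring
    rw [e, ← fourierCoef_sub i1 i2, ← fourierCoef_const_mul]
    congr 1
    ext x; ring
  have e2 : fourierCoef (fun x => w x * K x) n = Complex.exp (ρ n * Complex.I) * fourierCoef
      (fun x => Complex.exp ((-(2 * ρ n * x) : ℝ) * Complex.I) * K x) n := by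
    rw [← fourierCoef_const_mul]
    congr 1
    ext x
    rw [← mul_assoc, ← Complex.exp_add, hw]
    congr 2
    push_cast; ring_nf
  have h1 := h n
  rw [mul_add, mul_one, ← e2, Complex.add_im, Complex.exp_ofReal_mul_I_im] at h1
  rw [e1, Complex.sub_conj, ← Complex.ofReal_sin]
  have h2 : ((Real.sin (ρ n) : ℝ) : ℂ) + ((fourierCoef (fun x => w x * K x) n).im : ℂ) = 0 := by
    exact_mod_cast h1
  have hI : (Complex.I : ℂ) ≠ 0 := Complex.I_ne_zero
  rw [← h2]
  push_cast
  field_simp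

theorem exists_amplitude_kernel (hp : p ≠ ⊤) {q₁ q₂ : ℝ → ℝ}
    (hq₁ : MemLp q₁ p mu01) (hq₂ : MemLp q₂ p mu01) {θ : ℝ → ℝ → ℝ}
    (hθ : ∀ l, IsPruferAngle q₁ q₂ l (θ l)) :
    ∃ k : ℝ → Lp ℂ p (volume : Measure ℝ), Continuous k ∧ ∀ l, ∀ t ∈ Icc (0 : ℝ) 1,
      amplitude q₁ q₂ l (θ l) t = 1 + expFunctional p l (k t) := by
  have hq : MemLp (fun x => (q₁ x : ℂ) + q₂ x * Complex.I) p mu01 :=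
    MemLp.add (hq₁.ofReal (K := ℂ)) ((hq₂.ofReal (K := ℂ)).mul_const Complex.I)
  obtain ⟨k, hk, hke⟩ := exists_transformation_kernel hp hq
  exact ⟨k, hk, fun l => amplitude_eq_one_add_expFunctional (MemLp.intervalIntegrable_mu01 hq₁)
    (MemLp.intervalIntegrable_mu01 hq₂) (hθ l) hk (hke l)⟩

/-- The asymptotics of the spectral parameters at which the Prüfer angle takes the values
`π (n + c)`. -/
theorem exists_fourierCoef_eq_sub (hp : p ≠ ⊤) {q₁ q₂ : ℝ → ℝ}
    (hq₁ : MemLp q₁ p mu01) (hq₂ : MemLp q₂ p mu01) {θ : ℝ → ℝ → ℝ}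
    (hθ : ∀ l, IsPruferAngle q₁ q₂ l (θ l)) {ν : ℤ → ℝ} {c : ℝ}
    (hν : ∀ n, θ (ν n) 1 = Real.pi * (n + c)) :
    ∃ g : ℝ → ℂ, MemLp g p mu01 ∧
      ∀ n, fourierCoef g n = ((ν n - Real.pi * (n + c) : ℝ) : ℂ) := by
  have h₁ := MemLp.intervalIntegrable_mu01 hq₁
  have h₂ := MemLp.intervalIntegrable_mu01 hq₂
  obtain ⟨k, hk, hA⟩ := exists_amplitude_kernel hp hq₁ hq₂ hθ
  have hlim : Filter.Tendsto (fun n => ν n - Real.pi * (n + c)) Filter.cofinite (nhds 0) :=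
    tendsto_sub_of_pruferAngle_eq (fun l => (hθ l).abs_sub_le h₁ h₂)
      (tendsto_pruferAngle_sub hθ hk hA) hν
  -- Writing `ν n = πn + πc + ρ`, the shift `πc` is absorbed into the kernel, `πn` gives the Fourier
  -- exponential and `ρ` the small phase.
  have hK : MemLp (fun x : ℝ => Complex.exp (((-(2 * Real.pi * c * x) : ℝ) : ℂ) * Complex.I) *
      k 1 x) p volume := memLp_phase_mul (Lp.memLp (k 1)) (by fun_prop)
  refine exists_fourierCoef_eq_of_im_eq_zero hp hK hlim fun n => ?_
  have h1 := hA (ν n) 1 (right_mem_Icc.2 zero_le_one)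
  generalize hρ : ν n - Real.pi * (n + c) = ρ
  have e : fourierCoef (fun x => Complex.exp (((-(2 * ρ * x) : ℝ) : ℂ) * Complex.I) *
      (Complex.exp (((-(2 * Real.pi * c * x) : ℝ) : ℂ) * Complex.I) * k 1 x)) n =
      expFunctional p (ν n) (k 1) := by
    rw [fourierCoef, expFunctional_apply]
    refine integral_congr_ae (Filter.Eventually.of_forall fun x => ?_)
    simp only
    rw [← mul_assoc, ← mul_assoc, ← Complex.exp_add, ← Complex.exp_add]
    congr 2
    rw [← hρ]
    push_cast; ring
  rw [e, ← h1, amplitude, ← Complex.exp_add, hν]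
  -- At `ν n` the amplitude has phase exactly `-ρ`, so only the real radius survives.
  have e2 : (ρ : ℂ) * Complex.I + ((logRadius q₁ q₂ (θ (ν n)) 1 : ℂ) +
      (((Real.pi * (n + c) : ℝ) : ℂ) - (ν n : ℂ) * ((1 : ℝ) : ℂ)) * Complex.I) =
      ((logRadius q₁ q₂ (θ (ν n)) 1 : ℝ) : ℂ) := by
    rw [← hρ]; push_cast; ring
  rw [e2, Complex.exp_ofReal_im]

end

end Dirac

end

/-! ### The two eigenvalue sequences and their interlacing -/

theorem theorem3p1 (p : ENNReal) (hp1 : 1 ≤ p) (hp : p ≠ ⊤) (q₁ q₂ : ℝ → ℝ)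
    (hq₁ : MemLp q₁ p (volume.restrict (Ioo (0 : ℝ) 1)))
    (hq₂ : MemLp q₂ p (volume.restrict (Ioo (0 : ℝ) 1))) :
    ∃ lam mu : ℤ → ℝ,
      Dirac.EnumeratesEigenvalues (Dirac.diracOp q₁ q₂ 0) lam ∧
      Dirac.EnumeratesEigenvalues (Dirac.diracOp q₁ q₂ 1) mu ∧
      (∀ n : ℤ, lam (n - 1) < mu n ∧ mu n < lam n) ∧
      ∃ g₁ g₂ : ℝ → ℂ,
        MemLp g₁ p (volume.restrict (Ioo (0 : ℝ) 1)) ∧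
        MemLp g₂ p (volume.restrict (Ioo (0 : ℝ) 1)) ∧
        ∀ n : ℤ,
          (lam n : ℂ) = Real.pi * (n + 1 / 2) + Dirac.fourierCoef g₁ n ∧
          (mu n : ℂ) = Real.pi * n + Dirac.fourierCoef g₂ n := by
  have : Fact (1 ≤ p) := ⟨hp1⟩
  have h₁ := Dirac.MemLp.intervalIntegrable_mu01 hq₁
  have h₂ := Dirac.MemLp.intervalIntegrable_mu01 hq₂
  obtain ⟨θ, hθ, hmono, hsurj⟩ := Dirac.exists_pruferAngle_family h₁ h₂
  have hpi := Real.pi_pos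
  have hinj : ∀ (c : ℝ) (ν : ℤ → ℝ), (∀ n, θ (ν n) 1 = Real.pi * (n + c)) →
      Function.Injective ν := by
    intro c ν hν m n hmn
    have := (hν m).symm.trans ((congrArg (fun l => θ l 1) hmn).trans (hν n))
    have := mul_left_cancel₀ hpi.ne' this
    exact_mod_cast add_right_cancel this
  choose lam hlam using fun n : ℤ => hsurj (Real.pi * (n + (1 / 2 : ℝ)))
  replace hlam : ∀ n, θ (lam n) 1 = Real.pi * (n + (1 / 2 : ℝ)) := hlam
  choose mu hmu using fun n : ℤ => hsurj (Real.pi * (n + (0 : ℝ)))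
  replace hmu : ∀ n, θ (mu n) 1 = Real.pi * (n + (0 : ℝ)) := hmu
  obtain ⟨g₁, hg₁, e₁⟩ := Dirac.exists_fourierCoef_eq_sub hp hq₁ hq₂ hθ hlam
  obtain ⟨g₂, hg₂, e₂⟩ := Dirac.exists_fourierCoef_eq_sub hp hq₁ hq₂ hθ hmu
  refine ⟨lam, mu, Dirac.enumeratesEigenvalues h₁ h₂ hθ 0 (hinj _ lam hlam) fun l => ?_,
    Dirac.enumeratesEigenvalues h₁ h₂ hθ 1 (hinj _ mu hmu) fun l => ?_, fun n => ⟨?_, ?_⟩,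
    g₁, g₂, hg₁, hg₂, fun n => ⟨?_, ?_⟩⟩
  · change Real.cos (θ l 1) = 0 ↔ _
    rw [Real.cos_eq_zero_iff]
    refine exists_congr fun n => ?_
    rw [← hmono.injective.eq_iff (a := lam n), hlam]
    constructor <;> intro h <;> linarith
  · change Real.sin (θ l 1) = 0 ↔ _
    rw [Real.sin_eq_zero_iff]
    refine exists_congr fun n => ?_
    rw [← hmono.injective.eq_iff (a := mu n), hmu]
    constructor <;> intro h <;> linarith
  -- Monotonicity of the angle reduces interlacing to `n - 1/2 < n < n + 1/2`.
  · rw [← hmono.lt_iff_lt, hlam, hmu]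
    push_cast
    nlinarith
  · rw [← hmono.lt_iff_lt, hlam, hmu]
    nlinarith
  · rw [e₁]; push_cast; ring
  · rw [e₂]; push_cast; ring
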